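/- Let $p$ be an odd prime, let $m, r_1,\dots,r_t$ be positive integers with $m\mid r_j$ for all $j$, and suppose that $r=\sum_{j=1}^t r_j$ is even, $r\ge 4$ and $m\le r/2$. Let $V=\mathbb F_{p^{r_1}}\times\cdots\times\mathbb F_{p^{r_t}}$ with the inner product $\langle a,b\rangle=\sum_j \mathrm{Tr}_1^{r_j}(a_jb_j)$, where $\mathrm{Tr}_a^b$ is the trace from $\mathbb F_{p^b}$ to $\mathbb F_{p^a}$. For $f:V\to\mathbb F_p$ put $W_f(a)=\sum_{x\in V}\zeta_p^{f(x)-\langle a,x\rangle}$, $\zeta_p=e^{2\pi i/p}$; $f$ is bent if $|W_f(a)|=p^{r/2}$ for all $a\in V$, and (as $r$ is even) its dual $f^*:V\to\mathbb F_p$ is then given by $W_f(a)=\pm p^{r/2}\zeta_p^{f^*(a)}$. For $F:V\to\mathbb F_{p^m}$ and $c\in\mathbb F_{p^m}$ put $F_c(x)=\mathrm{Tr}_1^m(cF(x))$; $F$ is vectorial bent if all $F_c$, $c\ne0$, are bent. Let $F:V\to\mathbb F_{p^m}$ be vectorial bent with $F(0)=0$ and $F(-x)=F(x)$, and suppose that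 there are $\varepsilon\in\{1,-1\}$, a vectorial bent function $F^*:V\to\mathbb F_{p^m}$ and a positive integer $e$ with $\gcd(e,p^m-1)=1$ such that, for all $c\in\mathbb F_{p^m}^*$ and $x\in V$, $(F_c)^*=(F^*)_{c^{-e}}$, $W_{F_c}(x)=\varepsilon p^{r/2}\zeta_p^{(F_c)^*(x)}$ and $F^*(cx)=c^{e+1}F^*(x)$. Let $s_1,s_2$ be positive integers with $s_1\mid s_2\mid m$, let $\lambda\in\mathbb F_{p^m}^*$, and let $T$ be either the set of nonzero squares or the set of non-squares of $\mathbb F_{p^{s_2}}$. Put $D=\{x\in V\setminus\{0\}:\mathrm{Tr}_{s_2}^m(\lambda F(x))\in T\}$. For a sequence $d=(d_0,\dots,d_{n-1})$ of elements of $V$ consider the $p^{s_1}$-ary linear code $$\mathcal C(d)=\Big\{\Big(\sum_{j=1}^t\mathrm{Tr}_{s_1}^{r_j}(\alpha_j d_{i,j})\Big)_{0\le i\le n-1}:\ \alpha\in V\Big\},\qquad d_i=(d_{i,1},\dots,d_{i,t}).$$ Let $\mathcal C$ be one of the following. (I) $\mathcal C=\mathcal C(d)$, where $d$ lists the elements of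 $D$ without repetition. (II) $\mathcal C=\mathcal C(w)$, where one assumes in addition that there is an even positive integer $l_0$ with $F(cx)=c^{l_0}F(x)$ for all $c\in\mathbb F_{p^m}^*$, $x\in V$, and where $w=(w_0,\dots,w_{n-1})$ is a sequence of distinct elements of $D$ with $D=\bigcup_i w_i\mathbb F_{p^{s_1}}^*$ and $n=\frac{(p^{s_2}-1)(p^{r-s_2}-\varepsilon p^{r/2-s_2})}{2(p^{s_1}-1)}$. Assume that $s_2<\frac r2$ or $s_2\ne s_1$, and that $s_2\neq1$ if $p=3$, $r=4$, $\varepsilon=1$. Let $G=[g_0,\dots,g_{n-1}]$ be a generator matrix of $\mathcal C$, and let $d^\perp$ be the minimum distance of $\mathcal C^\perp$. In the secret sharing scheme based on $\mathcal C^\perp$ one takes a generator matrix $H$ of $\mathcal C^\perp$ and a vector $u$; the first entry of $uH$ is the secret and the other entries are the shares of the participants $P_1,\dots,P_{n-1}$. A set of participants is an access set if the secret is a function of the shares of its members, and a minimal access set if moreover no proper subset is an access set. Then this scheme has exactly $p^{r-s_1}$ minimal access sets, and: * In case (I), $d^\perp=2$. For $1\le i\le n-1$, if $g_i$ is a multiple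 of $g_0$, then $P_i$ is in every minimal access set; otherwise $P_i$ is in exactly $(p^{s_1}-1)p^{r-2s_1}$ minimal access sets. * In case (II), $d^\perp\ge3$. For every $1\le l\le\min\{\frac r{s_1}-1,\,d^\perp-2\}$, every set of $l$ participants is contained in exactly $p^{r-s_1(l+1)}(p^{s_1}-1)^l$ minimal access sets. -/

import Mathlib

namespace DualBentCodes

noncomputable section

/-! ## Vectorial dual-bent functions

Throughout, `V = ∏ j, L j` is a product of finite extensions `L j` of the prime field `ZMod p`,
and `M` is the finite field in which vectorial functions take their values. -/

/-- The trace inner product `∑ j, Tr (a j * b j)` on `∏ j, L j`, with values in the field `K`. -/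
def tracePairing (K : Type*) [Field K] {t : ℕ} {L : Fin t → Type*} [∀ j, Field (L j)]
    [∀ j, Algebra K (L j)] (a b : ∀ j, L j) : K :=
  ∑ j, Algebra.trace K (L j) (a j * b j)

section Bent

variable {p : ℕ} [Fact p.Prime] {t : ℕ} {L : Fin t → Type*} [∀ j, Field (L j)]
  [∀ j, Fintype (L j)] [∀ j, Algebra (ZMod p) (L j)]

/-- The Walsh transform `W_f(a) = ∑ x, ζ_p ^ (f x - ⟨a, x⟩)`. Here `ZMod.stdAddChar k = ζ_p ^ k`
with `ζ_p = exp (2 π i / p)`. -/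
def walsh (f : (∀ j, L j) → ZMod p) (a : ∀ j, L j) : ℂ :=
  ∑ x, ZMod.stdAddChar (f x - tracePairing (ZMod p) a x)

/-- `f` is bent: `|W_f(a)| = p ^ (r / 2)` for all `a`, where `r` is the dimension of the domain. -/
def IsBent (r : ℕ) (f : (∀ j, L j) → ZMod p) : Prop :=
  ∀ a, ‖walsh f a‖ = Real.sqrt p ^ r

/-- The constant `1` (if `p ≡ 1 mod 4` or `r` is even) or `√-1` (otherwise) that occurs in the
Walsh values of a bent function. -/
def walshUnit (p r : ℕ) : ℂ := if p % 4 = 1 ∨ Even r then 1 else Complex.I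

/-- `g` is the dual `f*` of the bent function `f`. -/
def IsDual (r : ℕ) (f g : (∀ j, L j) → ZMod p) : Prop :=
  ∀ a, ∃ δ : ℤ, (δ = 1 ∨ δ = -1) ∧
    walsh f a = δ * walshUnit p r * (Real.sqrt p : ℂ) ^ r * ZMod.stdAddChar (g a)

/-- `f` is weakly regular with dual `g` and constant `ε`. -/
def IsWeaklyRegular (r : ℕ) (ε : ℤ) (f g : (∀ j, L j) → ZMod p) : Prop :=
  ∀ a, walsh f a = ε * (Real.sqrt p : ℂ) ^ r * ZMod.stdAddChar (g a)

variable {M : Type*} [Field M] [Algebra (ZMod p) M]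

/-- The component function `F_c(x) = Tr (c F(x))`. -/
def component (F : (∀ j, L j) → M) (c : M) (x : ∀ j, L j) : ZMod p :=
  Algebra.trace (ZMod p) M (c * F x)

/-- `F` is vectorial bent: all `F_c` with `c ≠ 0` are bent. -/
def IsVectorialBent (r : ℕ) (F : (∀ j, L j) → M) : Prop :=
  ∀ c : M, c ≠ 0 → IsBent (p := p) r (component F c)

/-- `F` is vectorial dual-bent with vectorial dual `G` and permutation `σ` of `M \ {0}`. -/
structure IsVectorialDual (p : ℕ) [Fact p.Prime] [∀ j, Algebra (ZMod p) (L j)]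
    [Algebra (ZMod p) M] (r : ℕ) (F G : (∀ j, L j) → M) (σ : Equiv.Perm Mˣ) : Prop where
  bent : IsVectorialBent (p := p) r F
  bent_dual : IsVectorialBent (p := p) r G
  dual : ∀ c : Mˣ, IsDual (p := p) r (component F c) (component G (σ c))

/-- Condition A for `F : V → M`, with `r` the dimension of `V` and `m` that of `M` over the prime
field of odd characteristic `p`, and with the sign `ε`. -/
structure ConditionA [∀ j, Algebra M (L j)] (p : ℕ) [Fact p.Prime]
    [∀ j, Algebra (ZMod p) (L j)] [Algebra (ZMod p) M] (r m : ℕ)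
    (F : (∀ j, L j) → M) (ε : ℤ) : Prop where
  odd : p ≠ 2
  four_le : 4 ≤ r
  even : Even r
  le_half : m ≤ r / 2
  map_zero : F 0 = 0
  map_neg : ∀ x, F (-x) = F x
  sign : ε = 1 ∨ ε = -1
  dual : ∃ (G : (∀ j, L j) → M) (σ : Equiv.Perm Mˣ) (e : ℕ),
    IsVectorialDual p r F G σ ∧
    (∀ c : Mˣ, IsWeaklyRegular (p := p) r ε (component F c) (component G (σ c))) ∧
    0 < e ∧ Nat.gcd e (p ^ m - 1) = 1 ∧
    (∀ c : Mˣ, σ c = c ^ (-(e : ℤ))) ∧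
    (∀ (c : Mˣ) (x : ∀ j, L j), G ((c : M) • x) = (c : M) ^ (e + 1) * G x)

end Bent

/-! ## The defining sets -/

/-- The set `S` of nonzero squares of a field. -/
def squareSet (K : Type*) [Field K] : Set K := {y | ∃ x : K, x ≠ 0 ∧ y = x ^ 2}

/-- The set `N` of nonzero elements outside `S`. -/
def nonsquareSet (K : Type*) [Field K] : Set K := {y | y ≠ 0 ∧ y ∉ squareSet K}

/-- `D(F) = {x ≠ 0 | Tr (c F(x)) ∈ T}`, where `Tr` is the trace from `M` to `K`. -/
def defSet {K M V : Type*} [Field K] [Field M] [Algebra K M] [Zero V]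
    (F : V → M) (c : M) (T : Set K) : Set V :=
  {x | x ≠ 0 ∧ Algebra.trace K M (c * F x) ∈ T}

/-! ## Linear codes -/

section Codes

variable {K : Type*} [Field K]

/-- The code `{(∑ j, Tr (α j * d_i j))_i | α ∈ ∏ j, L j}` of a sequence `d` of points. -/
def traceCode (K : Type*) [Field K] {t : ℕ} {L : Fin t → Type*} [∀ j, Field (L j)]
    [∀ j, Algebra K (L j)] {n : ℕ} (d : Fin n → ∀ j, L j) : Submodule K (Fin n → K) where
  carrier := {c | ∃ α : ∀ j, L j, c = fun i => tracePairing K α (d i)}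
  zero_mem' := ⟨0, by funext i; simp [tracePairing]⟩
  add_mem' := by
    rintro _ _ ⟨α, rfl⟩ ⟨β, rfl⟩
    exact ⟨α + β, by funext i; simp [tracePairing, add_mul, Finset.sum_add_distrib]⟩
  smul_mem' := by
    rintro z _ ⟨α, rfl⟩
    exact ⟨z • α, by funext i; simp [tracePairing, Finset.mul_sum]⟩

/-- The dual code, with respect to the standard inner product. -/
def dualCode {n : ℕ} (C : Submodule K (Fin n → K)) : Submodule K (Fin n → K) where
  carrier := {u | ∀ v ∈ C, u ⬝ᵥ v = 0}
  zero_mem' := by intro v _; simp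
  add_mem' := by
    intro a b ha hb v hv
    rw [add_dotProduct, ha v hv, hb v hv, add_zero]
  smul_mem' := by
    intro z a ha v hv
    rw [smul_dotProduct, ha v hv, smul_zero]

open Classical in
/-- The minimum distance: the least Hamming weight of a nonzero codeword. -/
def minDist {n : ℕ} (C : Submodule K (Fin n → K)) : ℕ :=
  sInf {w | ∃ c ∈ C, c ≠ 0 ∧ hammingNorm c = w}

/-- `G` is a generator matrix of `C`: its rows form a basis of `C`. -/
def IsGeneratorMatrix {k n : ℕ} (G : Matrix (Fin k) (Fin n) K)
    (C : Submodule K (Fin n → K)) : Prop :=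
  LinearIndependent K G.row ∧ Submodule.span K (Set.range G.row) = C

/-! ## Secret sharing

In the scheme with generator matrix `H`, the dealer's vector `u` gives the secret `(u ᵥ* H) 0` and
the participant `i : Fin n` gets the share `(u ᵥ* H) i.succ`. -/

/-- The participants in `A` can compute the secret from their shares. -/
def IsAccessSet {k n : ℕ} (H : Matrix (Fin k) (Fin (n + 1)) K) (A : Finset (Fin n)) : Prop :=
  ∃ rec : (A → K) → K, ∀ u : Fin k → K,
    rec (fun i => Matrix.vecMul u H i.1.succ) = Matrix.vecMul u H 0

/-- The set of minimal access sets. -/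
def minimalAccessSets {k n : ℕ} (H : Matrix (Fin k) (Fin (n + 1)) K) : Set (Finset (Fin n)) :=
  {A | Minimal (IsAccessSet H) A}

end Codes

end

end DualBentCodes

open DualBentCodes

/-! The secret is a function of the shares in `A` exactly when the code C has a word with entry 1 at
position 0 and zeros outside A ∪ {0} (`isAccessSet_iff`). If any word of C whose support lies in
that of another is a multiple of it, supports identify the minimal access sets with the words having
entry 1 at 0 (`ncard_minimalAccessSets`). Those with nonzero entries on P are then counted by linear
algebra, provided no nonzero word of the dual code is supported on {0} ∪ P (`ncard_codewords_mul`).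

Minimality of all words comes from the Ashikhmin–Barg criterion: any two weights of nonzero words
have ratio above (q - 1)/q. Put f = Tr(λF), q = |K₁|, Q = |K₂| and R = p^(r/2). Detecting f(x) ∈ T
by additive characters expresses the Fourier coefficients of the indicator of D through Walsh values
of f, hence through a dual g. As e is odd and prime to Q - 1, z ↦ z^(-e) permutes the units of K₂
and differs from z ↦ z by square factors, which T absorbs; so only the truth of g(a) ∈ T matters
(`card_mul_sum_char`). This leaves at most two weights (`card_mul_weight`), and the restrictions on
the exponents are what the ratio needs (`two_mul_lt_of_exponents`).

The two cases differ only in the linear relations among the points. In (I), D = -D gives a dual word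
of weight 2; in (II), the prescribed length makes the representatives pairwise independent. -/

section Codes

/-! ### Access sets as supports of codewords. -/

variable {K : Type*} [Field K]

lemma mem_of_mem_dualCode_dualCode {n : ℕ} {C : Submodule K (Fin n → K)} {c : Fin n → K}
    (hc : c ∈ dualCode (dualCode C)) : c ∈ C := by
  by_contra h
  obtain ⟨φ, h1, h2⟩ := Submodule.exists_le_ker_of_notMem h
  have hφ : ∀ v : Fin n → K, φ v = v ⬝ᵥ fun i => φ (Pi.single i 1) := by
    intro v
    conv_lhs => rw [pi_eq_sum_univ' v, map_sum]
    simp [dotProduct]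
  apply h1
  rw [hφ]
  apply hc
  intro v hv
  rw [dotProduct_comm, ← hφ]
  exact h2 hv

lemma vecMul_mem_of_isGeneratorMatrix {k n : ℕ} {H : Matrix (Fin k) (Fin n) K}
    {C : Submodule K (Fin n → K)} (hH : IsGeneratorMatrix H C) (u : Fin k → K) :
    Matrix.vecMul u H ∈ C := by
  rw [← hH.2, Submodule.mem_span_range_iff_exists_fun]
  exact ⟨u, by rw [Matrix.vecMul_eq_sum]; rfl⟩

lemma mem_dualCode_iff_of_isGeneratorMatrix {k n : ℕ} {H : Matrix (Fin k) (Fin n) K}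
    {C : Submodule K (Fin n → K)} (hH : IsGeneratorMatrix H C) (c : Fin n → K) :
    c ∈ dualCode C ↔ ∀ u, Matrix.vecMul u H ⬝ᵥ c = 0 := by
  constructor
  · intro hc u
    rw [dotProduct_comm]
    exact hc _ (vecMul_mem_of_isGeneratorMatrix hH u)
  · intro h v hv
    rw [← hH.2, Submodule.mem_span_range_iff_exists_fun] at hv
    obtain ⟨u, rfl⟩ := hv
    rw [dotProduct_comm, ← h u, Matrix.vecMul_eq_sum]
    rfl

lemma isAccessSet_iff {k n : ℕ} {H : Matrix (Fin k) (Fin (n + 1)) K}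
    {C : Submodule K (Fin (n + 1) → K)} (hH : IsGeneratorMatrix H (dualCode C))
    (A : Finset (Fin n)) :
    IsAccessSet H A ↔ ∃ c ∈ C, c 0 = 1 ∧ ∀ i ∉ A, c (Fin.succ i) = 0 := by
  classical
  constructor
  · rintro ⟨rec, hrec⟩
    let φ : Fin (n + 1) → (Fin k → K) →ₗ[K] K := fun i => (LinearMap.proj i) ∘ₗ H.vecMulLinear
    have hφ : ∀ i u, φ i u = Matrix.vecMul u H i := fun i u => rfl
    -- The map `rec` need not be linear. Comparing with u = 0 still shows that vanishing shares
    -- force a vanishing secret, so the secret functional lies in the span of the share functionals.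
    have h0 : (⨅ i : A, LinearMap.ker (φ i.1.succ)) ≤ LinearMap.ker (φ 0) := by
      intro u hu
      simp only [Submodule.mem_iInf, LinearMap.mem_ker, hφ] at hu
      rw [LinearMap.mem_ker, hφ, ← hrec u]
      have := hrec 0
      simp only [Matrix.zero_vecMul, Pi.zero_apply] at this
      rw [← this]
      congr 1
      funext i
      exact hu i
    obtain ⟨b, hb⟩ := (Submodule.mem_span_range_iff_exists_fun K).1 (mem_span_of_iInf_ker_le_ker h0)
    let c : Fin (n + 1) → K :=
      Fin.cons 1 (fun i => if h : i ∈ A then - b ⟨i, h⟩ else 0)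
    refine ⟨c, ?_, rfl, fun i hi => by simp [c, hi]⟩
    apply mem_of_mem_dualCode_dualCode
    rw [mem_dualCode_iff_of_isGeneratorMatrix hH]
    intro u
    have hu := LinearMap.congr_fun hb u
    simp only [LinearMap.sum_apply, LinearMap.smul_apply, hφ, smul_eq_mul] at hu
    have hs : ∑ i : Fin n, Matrix.vecMul u H i.succ * c i.succ
        = ∑ i ∈ A, Matrix.vecMul u H i.succ * c i.succ := by
      symm
      apply Finset.sum_subset (Finset.subset_univ _)
      intro i _ hi
      simp [c, hi]
    rw [dotProduct, Fin.sum_univ_succ, hs, ← Finset.sum_coe_sort A, ← hu]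
    simp only [c, Fin.cons_zero, Fin.cons_succ, mul_one, ← Finset.sum_add_distrib]
    apply Finset.sum_eq_zero
    intro i _
    simp [mul_comm]
  · rintro ⟨c, hc, h0, hA⟩
    refine ⟨fun s => - ∑ i : A, s i * c i.1.succ, fun u => ?_⟩
    have h := vecMul_mem_of_isGeneratorMatrix hH u c hc
    have hs : ∑ i : Fin n, Matrix.vecMul u H i.succ * c i.succ
        = ∑ i ∈ A, Matrix.vecMul u H i.succ * c i.succ := by
      symm
      apply Finset.sum_subset (Finset.subset_univ _)
      intro i _ hi
      simp [hA i hi]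
    rw [dotProduct, Fin.sum_univ_succ, hs, ← Finset.sum_coe_sort A, h0, mul_one] at h
    exact (eq_neg_of_add_eq_zero_left h).symm

/-- Every codeword whose support lies in that of `c` is a multiple of `c`. -/
def AllCodewordsMinimal {n : ℕ} (C : Submodule K (Fin n → K)) : Prop :=
  ∀ c ∈ C, ∀ c' ∈ C, (∀ i, c i = 0 → c' i = 0) → ∃ z : K, c' = z • c

lemma ncard_minimalAccessSets {k n : ℕ} {H : Matrix (Fin k) (Fin (n + 1)) K}
    {C : Submodule K (Fin (n + 1) → K)} (hH : IsGeneratorMatrix H (dualCode C))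
    (hC : AllCodewordsMinimal C) (P : Finset (Fin n)) :
    {A ∈ minimalAccessSets H | P ⊆ A}.ncard =
      {c | c ∈ C ∧ c 0 = 1 ∧ ∀ i ∈ P, c (Fin.succ i) ≠ 0}.ncard := by
  classical
  let S : (Fin (n + 1) → K) → Finset (Fin n) := fun c => {i | c i.succ ≠ 0}
  have hS : ∀ c i, i ∈ S c ↔ c (Fin.succ i) ≠ 0 := by intro c i; simp [S]
  have heq : ∀ c ∈ C, ∀ c' ∈ C, c 0 = 1 → c' 0 = 1 → S c' ⊆ S c → c' = c := by
    intro c hc c' hc' h h' hs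
    obtain ⟨z, rfl⟩ := hC c hc c' hc' (by
      intro i
      refine Fin.cases ?_ (fun j => ?_) i
      · simp [h]
      · intro hj
        by_contra hj'
        exact (hS c j).1 (hs ((hS c' j).2 hj')) hj)
    simp only [Pi.smul_apply, h, smul_eq_mul, mul_one] at h'
    simp [h']
  have hacc : ∀ c ∈ C, c 0 = 1 → IsAccessSet H (S c) := fun c hc h =>
    (isAccessSet_iff hH _).2 ⟨c, hc, h, fun i hi => by simpa [hS] using hi⟩
  have himg : {A ∈ minimalAccessSets H | P ⊆ A} =
      S '' {c | c ∈ C ∧ c 0 = 1 ∧ ∀ i ∈ P, c (Fin.succ i) ≠ 0} := by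
    ext A
    simp only [minimalAccessSets, Set.mem_ofPred_eq, Set.mem_image]
    constructor
    · rintro ⟨hA, hP⟩
      obtain ⟨c, hc, h0, hcA⟩ := (isAccessSet_iff hH A).1 hA.1
      have hsub : S c ⊆ A := by
        intro i hi
        by_contra h
        exact (hS c i).1 hi (hcA i h)
      have hAS : A = S c := le_antisymm (hA.2 (hacc c hc h0) hsub) hsub
      exact ⟨c, ⟨hc, h0, fun i hi => (hS c i).1 (hAS ▸ hP hi)⟩, hAS.symm⟩
    · rintro ⟨c, ⟨hc, h0, hP⟩, rfl⟩
      refine ⟨⟨hacc c hc h0, ?_⟩, fun i hi => (hS c i).2 (hP i hi)⟩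
      intro A hA hAS
      obtain ⟨c', hc', h0', hcA⟩ := (isAccessSet_iff hH A).1 hA
      have hsub : S c' ⊆ A := by
        intro i hi
        by_contra h
        exact (hS c' i).1 hi (hcA i h)
      rw [← heq c hc c' hc' h0 h0' (hsub.trans hAS)]
      exact hsub
  rw [himg, Set.InjOn.ncard_image]
  rintro c ⟨hc, h0, -⟩ c' ⟨hc', h0', -⟩ h
  exact (heq c hc c' hc' h0 h0' h.symm.subset).symm

/-- The number of codewords with first entry `1` and nonzero entries at `P` when the positions
`0` and `P` are independent. -/
lemma ncard_codewords_mul [Fintype K] {n : ℕ} {C : Submodule K (Fin (n + 1) → K)}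
    (P : Finset (Fin n))
    (hP : ∀ u ∈ dualCode C, (∀ i ∉ P, u (Fin.succ i) = 0) → u = 0) :
    {c | c ∈ C ∧ c 0 = 1 ∧ ∀ i ∈ P, c (Fin.succ i) ≠ 0}.ncard * Fintype.card K ^ (P.card + 1) =
      Nat.card C * (Fintype.card K - 1) ^ P.card := by
  classical
  let π : C →ₗ[K] K × (P → K) :=
    { toFun := fun c => (c.1 0, fun i => c.1 i.1.succ)
      map_add' := fun _ _ => rfl
      map_smul' := fun _ _ => rfl }
  -- A functional vanishing on the range of π is a dual word supported on {0} ∪ P, hence zero.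
  have hsurj : Function.Surjective π := by
    rw [← LinearMap.range_eq_top]
    by_contra hne
    obtain ⟨φ, hφ, hle⟩ := Submodule.exists_le_ker_of_lt_top _ (lt_top_iff_ne_top.2 hne)
    have hφe : ∀ a b, φ (a, b) = a * φ (1, 0) + ∑ i, b i * φ (0, Pi.single i 1) := by
      intro a b
      have h1 : (a, b) = a • ((1 : K), (0 : P → K))
          + ∑ i, b i • ((0 : K), (Pi.single i 1 : P → K)) := by
        ext
        · simp [Prod.fst_sum]
        · simp [Prod.snd_sum, Finset.sum_apply, Pi.single_apply]
      rw [h1, map_add, map_sum]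
      simp only [map_smul, smul_eq_mul]
    let u : Fin (n + 1) → K :=
      Fin.cons (φ (1, 0)) (fun i => if h : i ∈ P then φ (0, Pi.single ⟨i, h⟩ 1) else 0)
    have hu : u = 0 := by
      apply hP u
      · intro c hc
        have h := hle ⟨⟨c, hc⟩, rfl⟩
        rw [LinearMap.mem_ker] at h
        change φ (c 0, fun i => c i.1.succ) = 0 at h
        rw [hφe] at h
        rw [dotProduct, Fin.sum_univ_succ]
        have hs : ∑ i : Fin n, u i.succ * c i.succ = ∑ i ∈ P, u i.succ * c i.succ := by
          symm
          apply Finset.sum_subset (Finset.subset_univ _)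
          intro i _ hi
          simp [u, hi]
        rw [hs, ← Finset.sum_coe_sort P, ← h]
        simp [u, mul_comm]
      · intro i hi
        simp [u, hi]
    apply hφ
    ext
    · simpa [u] using congrFun hu 0
    · rename_i i
      simpa [u] using congrFun hu i.1.succ
  let N : ℕ := ({g : C | π g = 0} : Finset C).card
  have hfib : ∀ y, ({g : C | π g = y} : Finset C).card = N := fun y =>
    AddMonoidHom.card_fiber_eq_of_mem_range π (hsurj y) (hsurj 0)
  have hcount : ∀ Y : Finset (K × (P → K)),
      ({g : C | π g ∈ Y} : Finset C).card = Y.card * N := by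
    intro Y
    rw [Finset.card_eq_sum_card_fiberwise (f := π) (t := Y) (by intro x hx; simpa using hx),
      ← smul_eq_mul, ← Finset.sum_const]
    apply Finset.sum_congr rfl
    intro y hy
    rw [← hfib y, Finset.filter_filter]
    congr 1
    ext g
    simp only [Finset.mem_filter, Finset.mem_univ, true_and]
    constructor
    · exact fun h => h.2
    · rintro rfl
      exact ⟨hy, rfl⟩
  have hall : Nat.card C = Fintype.card K ^ (P.card + 1) * N := by
    have := hcount Finset.univ
    simp only [Finset.mem_univ, Finset.filter_true, Finset.card_univ, Fintype.card_prod,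
      Fintype.card_fun, Fintype.card_coe] at this
    rw [Nat.card_eq_fintype_card, this, pow_succ']
  have hsel : {c | c ∈ C ∧ c 0 = 1 ∧ ∀ i ∈ P, c (Fin.succ i) ≠ 0}.ncard
      = (Fintype.card K - 1) ^ P.card * N := by
    have h1 := hcount ({1} ×ˢ Fintype.piFinset (fun _ => {0}ᶜ))
    rw [Finset.card_product, Fintype.card_piFinset] at h1
    simp only [Finset.card_singleton, one_mul, Finset.card_compl, Finset.prod_const,
      Finset.card_univ, Fintype.card_coe] at h1
    rw [← h1, ← Set.ncard_coe_finset, ← Set.ncard_image_of_injective _ Subtype.val_injective]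
    congr 1
    ext c
    simp [π, Fintype.mem_piFinset, eq_comm (a := (1 : K))]
    tauto
  rw [hall, hsel]
  ring

end Codes

/-! ### Character sums over quadratic classes. -/

section CharacterSums

lemma sum_units_eq_sub {K : Type*} [Field K] [Fintype K] [Fintype Kˣ] (φ : K → ℂ) :
    ∑ u : Kˣ, φ u = ∑ x, φ x - φ 0 := by
  classical
  rw [Fintype.sum_eq_add_sum_compl (0 : K), add_sub_cancel_left]
  apply Finset.sum_nbij (fun u : Kˣ => (u : K))
  · intro u _
    simp
  · intro u _ v _ h
    exact Units.ext h
  · intro x hx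
    exact ⟨Units.mk0 x (by simpa using hx), by simp⟩
  · intro u _
    rfl

lemma ringChar_ne_two_of_two_ne_zero {K : Type*} [Field K] (h : (2 : K) ≠ 0) : ringChar K ≠ 2 :=
  fun h2 => h (by exact_mod_cast (ringChar.spec K 2).2 h2.dvd)

/-- `T` is a union of cosets of the nonzero squares, and contains half of the units. -/
structure IsQuadraticClass {K : Type*} [Field K] [Fintype K] (T : Finset K) : Prop where
  sq_mul_mem : ∀ s y : K, s ≠ 0 → y ∈ T → s ^ 2 * y ∈ T
  zero_notMem : (0 : K) ∉ T
  two_mul_card : 2 * (T.card : ℤ) = Fintype.card K - 1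

lemma isQuadraticClass_toFinset {K : Type*} [Field K] [Fintype K] (h2 : (2 : K) ≠ 0) {T : Set K}
    [Fintype T] (hT : T = squareSet K ∨ T = nonsquareSet K) : IsQuadraticClass T.toFinset := by
  classical
  have hchar := ringChar_ne_two_of_two_ne_zero h2
  have hsq : ∀ y : K, y ∈ squareSet K ↔ quadraticChar K y = 1 := by
    intro y
    constructor
    · rintro ⟨x, hx, rfl⟩
      exact quadraticChar_sq_one' hx
    · intro h
      have hy : y ≠ 0 := by rintro rfl; simp at h
      obtain ⟨x, hx⟩ := (quadraticChar_one_iff_isSquare hy).1 h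
      exact ⟨x, by rintro rfl; simp at hx; exact hy hx, by rw [hx, sq]⟩
  have hns : ∀ y : K, y ∈ nonsquareSet K ↔ quadraticChar K y = -1 := by
    intro y
    rw [nonsquareSet, Set.mem_ofPred_eq, hsq]
    constructor
    · rintro ⟨h0, h1⟩
      exact (quadraticChar_dichotomy h0).resolve_left h1
    · intro h
      exact ⟨by rintro rfl; simp at h, by rw [h]; decide⟩
  have key : ∃ δ : ℤ, (δ = 1 ∨ δ = -1) ∧ ∀ y, y ∈ T.toFinset ↔ quadraticChar K y = δ := by
    rcases hT with rfl | rfl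
    · exact ⟨1, Or.inl rfl, by simpa using hsq⟩
    · exact ⟨-1, Or.inr rfl, by simpa using hns⟩
  obtain ⟨δ, hδ, hmem⟩ := key
  refine ⟨?_, ?_, ?_⟩
  · intro s y hs hy
    rw [hmem] at hy ⊢
    rw [map_mul, quadraticChar_sq_one' hs, one_mul, hy]
  · rw [hmem]
    simp only [MulChar.map_zero]
    rcases hδ with rfl | rfl <;> decide
  · have h1 := quadraticChar_sum_zero hchar
    have h3 : ∑ y : K, (δ * quadraticChar K y + 1) = Fintype.card K := by
      rw [Finset.sum_add_distrib, ← Finset.mul_sum, h1]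
      simp
    -- The left side is 2 on T, 1 at 0 and 0 elsewhere; summing over the field gives |T|.
    have h4 : ∀ y : K, δ * quadraticChar K y + 1 =
        2 * (if y ∈ T.toFinset then 1 else 0) + if y = 0 then 1 else 0 := by
      intro y
      simp only [hmem]
      by_cases hy : y = 0
      · subst hy
        rcases hδ with rfl | rfl <;> simp
      · rcases hδ with rfl | rfl <;> rcases quadraticChar_dichotomy hy with h | h <;>
          simp [h, hy]
    simp only [h4, Finset.sum_add_distrib, ← Finset.mul_sum, Finset.sum_ite_mem,
      Finset.univ_inter, Finset.sum_const, Finset.sum_ite_eq', Finset.mem_univ, if_true,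
      nsmul_eq_mul, mul_one] at h3
    linarith

variable {K₁ K₂ V : Type*} [Field K₁] [Field K₂] [Fintype K₁] [Fintype K₂]
  [AddCommGroup V] [Module K₁ V] [Fintype V]

lemma sum_ite_char [DecidableEq K₂] {χ : AddChar K₂ ℂ} (hχ : χ.IsPrimitive) (T : Finset K₂)
    (h : K₂) :
    ∑ y ∈ T, ∑ z : K₂, χ (z * (h - y)) = Fintype.card K₂ * (if h ∈ T then 1 else 0) := by
  simp only [AddChar.sum_mulShift _ hχ, sub_eq_zero, Nat.cast_ite, Nat.cast_zero,
    Finset.sum_ite_eq]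
  split_ifs <;> simp

/-- Since e is odd, z^(-e) is z times a nonzero square, so replacing y by that square times y, which
preserves T, turns z into z^(-e) in the first character. Coprimality lets u = z^(-e) run over all
units, and orthogonality finishes after removing the term u = 0, which is |T|. -/
lemma sum_units_char_mul_char [DecidableEq K₂] {χ : AddChar K₂ ℂ} (hχ : χ.IsPrimitive)
    {T : Finset K₂} (hT : IsQuadraticClass T) {e : ℕ} (hodd : Odd e)
    (he : (Nat.card K₂ˣ).Coprime e) (h : K₂) :
    ∑ z : K₂ˣ, ∑ y ∈ T, χ (-(z * y)) * χ (((z : K₂)⁻¹) ^ e * h) =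
      Fintype.card K₂ * (if h ∈ T then 1 else 0) - T.card := by
  have h1 : ∀ z : K₂ˣ, ∑ y ∈ T, χ (-(z * y)) * χ (((z : K₂)⁻¹) ^ e * h) =
      ∑ y ∈ T, χ (((((z⁻¹) ^ e : K₂ˣ)) : K₂) * (h - y)) := by
    intro z
    obtain ⟨k, hk⟩ := hodd
    have hz : (z : K₂) ≠ 0 := z.ne_zero
    have hs : ((z : K₂)⁻¹) ^ e = z * ((z : K₂)⁻¹ ^ (k + 1)) ^ 2 := by
      rw [← pow_mul, show (k + 1) * 2 = e + 1 by omega, pow_succ]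
      field_simp
    symm
    apply Finset.sum_nbij' (fun y => ((z : K₂)⁻¹ ^ (k + 1)) ^ 2 * y)
      (fun y => ((z : K₂) ^ (k + 1)) ^ 2 * y)
    · intro y hy
      exact hT.sq_mul_mem _ _ (pow_ne_zero _ (inv_ne_zero hz)) hy
    · intro y hy
      exact hT.sq_mul_mem _ _ (pow_ne_zero _ hz) hy
    · intro y _
      simp only [inv_pow]
      field_simp
    · intro y _
      simp only [inv_pow]
      field_simp
    · intro y _
      rw [← AddChar.map_add_eq_mul, ← mul_assoc, ← hs]
      congr 1
      push_cast
      ring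
  rw [Finset.sum_congr rfl fun z _ => h1 z]
  have h2 := Equiv.sum_comp ((Equiv.inv K₂ˣ).trans (powCoprime he))
    (fun u : K₂ˣ => ∑ y ∈ T, χ ((u : K₂) * (h - y)))
  simp only [Equiv.trans_apply, Equiv.inv_apply, powCoprime_apply] at h2
  rw [h2, sum_units_eq_sub (fun u : K₂ => ∑ y ∈ T, χ (u * (h - y))), Finset.sum_comm,
    sum_ite_char hχ]
  simp

/-- The sum of an additive character over the values of a nonzero functional. -/
lemma sum_char_functional [DecidableEq V] {ψ : AddChar K₁ ℂ} (hψ : ψ.IsPrimitive)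
    {B : V →ₗ[K₁] V →ₗ[K₁] K₁} (hB : ∀ a, (∀ x, B a x = 0) → a = 0) (a : V) :
    ∑ x, ψ (-(B a x)) = if a = 0 then (Fintype.card V : ℂ) else 0 := by
  classical
  have h := AddChar.sum_eq_ite (ψ.compAddMonoidHom (-(B a)).toAddMonoidHom)
  simp only [AddChar.compAddMonoidHom_apply, LinearMap.toAddMonoidHom_coe,
    LinearMap.neg_apply] at h
  rw [h]
  congr 1
  refine propext ⟨fun h0 => ?_, ?_⟩
  · by_contra ha
    obtain ⟨x, hx⟩ : ∃ x, B a x ≠ 0 := by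
      by_contra! hx
      exact ha (hB a hx)
    have h1 := hψ (a := 1) one_ne_zero
    apply h1
    ext y
    -- A nonzero functional is surjective: this multiple of x makes -B(a, ·) take the arbitrary
    -- value y, so ψ would be trivial.
    have := DFunLike.congr_fun h0 (-(y * (B a x)⁻¹) • x)
    simp only [AddChar.compAddMonoidHom_apply, LinearMap.toAddMonoidHom_coe,
      LinearMap.neg_apply, map_smul, smul_eq_mul, AddChar.zero_apply] at this
    rw [AddChar.mulShift_apply, one_mul, AddChar.one_apply, ← this]
    congr 1
    field_simp
  · rintro rfl
    ext x
    simp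

/-- The functions `f` and `g` are dual to each other with respect to the characters `χ` and `ψ`:
all Walsh values of the components `z f` are given by the components `z ^ (-e) g`. -/
structure IsDualPair (B : V →ₗ[K₁] V →ₗ[K₁] K₁) (ψ : AddChar K₁ ℂ) (χ : AddChar K₂ ℂ)
    (f g : V → K₂) (ε : ℤ) (e R : ℕ) : Prop where
  prim₁ : ψ.IsPrimitive
  prim₂ : χ.IsPrimitive
  nondegenerate : ∀ a, (∀ x, B a x = 0) → a = 0
  odd : Odd e
  coprime : (Nat.card K₂ˣ).Coprime e
  walsh : ∀ z : K₂, z ≠ 0 → ∀ a, ∑ x, χ (z * f x) * ψ (-(B a x)) = ε * R * χ (z⁻¹ ^ e * g a)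
  card : Fintype.card V = R ^ 2
  eval_zero : f 0 = 0
  eval_neg : ∀ x, f (-x) = f x
  dual_smul : ∀ (b : K₁) (a : V), b ≠ 0 → ∃ s : K₂, s ≠ 0 ∧ g (b • a) = s ^ 2 * g a
  sign : ε = 1 ∨ ε = -1
  two_ne_zero : (2 : K₁) ≠ 0
  two_ne_zero' : (2 : K₂) ≠ 0

/-! ### Size of the defining set, weights and minimality. -/

namespace IsDualPair

variable {B : V →ₗ[K₁] V →ₗ[K₁] K₁} {ψ : AddChar K₁ ℂ} {χ : AddChar K₂ ℂ}
    {f g : V → K₂} {ε : ℤ} {e R : ℕ} {T : Finset K₂}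

lemma card_mul_sum_char [DecidableEq V] [DecidableEq K₂] (h : IsDualPair B ψ χ f g ε e R)
    (hT : IsQuadraticClass T) (a : V) :
    (Fintype.card K₂ : ℂ) * ∑ x with f x ∈ T, ψ (-(B a x)) =
      (if a = 0 then (T.card * R ^ 2 : ℂ) else 0) +
        ε * R * (Fintype.card K₂ * (if g a ∈ T then 1 else 0) - T.card) := by
  have h1 : (Fintype.card K₂ : ℂ) * ∑ x with f x ∈ T, ψ (-(B a x)) =
      ∑ z : K₂, ∑ y ∈ T, χ (-(z * y)) * ∑ x, χ (z * f x) * ψ (-(B a x)) := by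
    calc _ = ∑ x, (∑ y ∈ T, ∑ z : K₂, χ (z * (f x - y))) * ψ (-(B a x)) := by
          rw [Finset.sum_filter, Finset.mul_sum]
          apply Finset.sum_congr rfl
          intro x _
          rw [sum_ite_char h.prim₂]
          split_ifs <;> simp
      _ = ∑ z : K₂, ∑ y ∈ T, ∑ x, χ (z * (f x - y)) * ψ (-(B a x)) := by
          simp only [Finset.sum_mul]
          rw [Finset.sum_comm]
          rw [Finset.sum_comm (s := Finset.univ (α := K₂))]
          apply Finset.sum_congr rfl
          intro y _
          rw [Finset.sum_comm]
      _ = _ := by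
          apply Finset.sum_congr rfl
          intro z _
          apply Finset.sum_congr rfl
          intro y _
          rw [Finset.mul_sum]
          apply Finset.sum_congr rfl
          intro x _
          rw [← mul_assoc, ← AddChar.map_add_eq_mul]
          congr 2
          ring
  -- The term z = 0 contributes only at a = 0; the terms z ≠ 0 are Walsh values, given by duality.
  have h2 := sum_units_eq_sub
    (fun z : K₂ => ∑ y ∈ T, χ (-(z * y)) * ∑ x, χ (z * f x) * ψ (-(B a x)))
  have h3 : ∑ z : K₂ˣ, ∑ y ∈ T, χ (-(z * y)) * ∑ x, χ (z * f x) * ψ (-(B a x)) =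
      ε * R * ∑ z : K₂ˣ, ∑ y ∈ T, χ (-(z * y)) * χ (((z : K₂)⁻¹) ^ e * g a) := by
    simp only [Finset.mul_sum]
    apply Finset.sum_congr rfl
    intro z _
    apply Finset.sum_congr rfl
    intro y _
    rw [← Finset.mul_sum, h.walsh z z.ne_zero]
    ring
  rw [sum_units_char_mul_char h.prim₂ hT h.odd h.coprime] at h3
  rw [h1, sub_eq_iff_eq_add.1 h2.symm, h3, add_comm]
  congr 1
  simp only [zero_mul, neg_zero, AddChar.map_zero_eq_one, one_mul,
    sum_char_functional h.prim₁ h.nondegenerate, h.card, Finset.sum_const, nsmul_eq_mul]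
  split_ifs <;> simp

lemma even_card [DecidableEq K₂] (h : IsDualPair B ψ χ f g ε e R) (hT : IsQuadraticClass T) :
    Even ({x | f x ∈ T} : Finset V).card := by
  classical
  rw [even_iff_two_dvd, ← ZMod.natCast_eq_zero_iff, Finset.card_eq_sum_ones, Nat.cast_sum]
  apply Finset.sum_involution (fun x _ => -x)
  · intro x _
    decide
  · intro x hx _ hneg
    have h2 : (2 : K₁) • x = 0 := by
      rw [two_smul]
      nth_rewrite 1 [← hneg]
      simp
    rw [smul_eq_zero_iff_right h.two_ne_zero] at h2
    subst h2
    simp [h.eval_zero, hT.zero_notMem] at hx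
  · intro x _
    simp
  · intro x hx
    simp only [Finset.mem_filter, Finset.mem_univ, true_and] at hx ⊢
    rwa [h.eval_neg]

lemma odd_card_field {K : Type*} [Field K] [Fintype K] (h : (2 : K) ≠ 0) :
    Odd (Fintype.card K) := by
  rw [Nat.odd_iff]
  exact FiniteField.odd_card_of_char_ne_two (ringChar_ne_two_of_two_ne_zero h)

lemma odd_radius (h : IsDualPair B ψ χ f g ε e R) : Odd R := by
  have h1 : Odd (Fintype.card V) := by
    rw [Module.card_eq_pow_finrank (K := K₁)]
    exact (odd_card_field h.two_ne_zero).pow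
  rw [h.card] at h1
  exact (Nat.odd_pow_iff (by norm_num)).1 h1

lemma card_mul_card_aux [DecidableEq K₂] (h : IsDualPair B ψ χ f g ε e R)
    (hT : IsQuadraticClass T) :
    (Fintype.card K₂ : ℤ) * ({x | f x ∈ T} : Finset V).card =
      T.card * R ^ 2 + ε * R * (Fintype.card K₂ * (if g 0 ∈ T then 1 else 0) - T.card) := by
  classical
  have h1 := h.card_mul_sum_char hT 0
  simp only [map_zero, LinearMap.zero_apply, neg_zero, AddChar.map_zero_eq_one, Finset.sum_const,
    nsmul_eq_mul, mul_one, if_true] at h1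
  exact_mod_cast h1

/-- A parity argument. The set {f ∈ T} is even in size, being closed under the fixed-point-free map
x ↦ -x. If g(0) were in T, the counting identity would equate an even number with |T|R(R - ε) + εRQ,
which is odd because R and Q are odd. -/
lemma dual_zero_notMem [DecidableEq K₂] (h : IsDualPair B ψ χ f g ε e R)
    (hT : IsQuadraticClass T) : g 0 ∉ T := by
  intro h0
  have h1 := h.card_mul_card_aux hT
  rw [if_pos h0] at h1
  obtain ⟨k, hk⟩ := h.even_card hT
  obtain ⟨l, hl⟩ := h.odd_radius
  obtain ⟨m, hm⟩ := odd_card_field h.two_ne_zero'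
  rw [hk, hl, hm] at h1
  push_cast at h1
  have h2 : (2 : ℤ) ∣ 1 := by
    rcases h.sign with rfl | rfl
    · exact ⟨(2 * m + 1) * k - T.card * (2 * l + 1) * l - 2 * l * m - l - m, by
        linear_combination -h1⟩
    · exact ⟨T.card * (2 * l + 1) * (l + 1) - (2 * m + 1) * k - 2 * l * m - l - m, by
        linear_combination h1⟩
  exact absurd h2 (by decide)

lemma card_mul_card [DecidableEq K₂] (h : IsDualPair B ψ χ f g ε e R)
    (hT : IsQuadraticClass T) :
    2 * (Fintype.card K₂ : ℤ) * ({x | f x ∈ T} : Finset V).card =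
      (Fintype.card K₂ - 1) * (R ^ 2 - ε * R) := by
  have h1 := h.card_mul_card_aux hT
  rw [if_neg (h.dual_zero_notMem hT)] at h1
  linear_combination 2 * h1 + (R ^ 2 - ε * R) * hT.two_mul_card

lemma dual_smul_mem_iff (h : IsDualPair B ψ χ f g ε e R) (hT : IsQuadraticClass T)
    {b : K₁} (hb : b ≠ 0) (a : V) : g (b • a) ∈ T ↔ g a ∈ T := by
  have h1 : ∀ (b : K₁) (a : V), b ≠ 0 → g a ∈ T → g (b • a) ∈ T := by
    intro b a hb ha
    obtain ⟨s, hs, h2⟩ := h.dual_smul b a hb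
    rw [h2]
    exact hT.sq_mul_mem s _ hs ha
  refine ⟨fun h2 => ?_, h1 b a hb⟩
  have := h1 b⁻¹ _ (inv_ne_zero hb) h2
  rwa [inv_smul_smul₀ hb] at this

/-- The weight of the codeword of `a` in the code of `{x | f x ∈ T}`. -/
lemma card_mul_weight [DecidableEq K₁] [DecidableEq K₂] (h : IsDualPair B ψ χ f g ε e R)
    (hT : IsQuadraticClass T) {a : V} (ha : a ≠ 0) :
    2 * (Fintype.card K₁ : ℤ) * Fintype.card K₂ *
        ({x | f x ∈ T ∧ B a x ≠ 0} : Finset V).card =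
      (Fintype.card K₁ - 1) * R *
        ((Fintype.card K₂ - 1) * R - 2 * ε * Fintype.card K₂ * (if g a ∈ T then 1 else 0)) := by
  classical
  -- Orthogonality over K₁ counts the zeros of the codeword. The term b = 0 is the full length, and
  -- all b ≠ 0 contribute equally because g(ba) ∈ T exactly when g(a) ∈ T.
  have hN : (Fintype.card K₁ : ℂ) * ({x | f x ∈ T ∧ B a x = 0} : Finset V).card =
      ∑ b : K₁, ∑ x with f x ∈ T, ψ (-(B (b • a) x)) := by
    rw [Finset.sum_comm, ← Finset.filter_filter, Finset.card_filter]
    push_cast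
    rw [Finset.mul_sum]
    apply Finset.sum_congr rfl
    intro x _
    have := AddChar.sum_mulShift (-(B a x)) h.prim₁
    simp only [mul_neg, neg_eq_zero] at this
    simp only [map_smul, LinearMap.smul_apply, smul_eq_mul]
    rw [this]
    split_ifs <;> simp
  have hS := sum_units_eq_sub (fun b : K₁ => (Fintype.card K₂ : ℂ) *
    ∑ x with f x ∈ T, ψ (-(B (b • a) x)))
  have hu : ∀ b : K₁ˣ, (Fintype.card K₂ : ℂ) *
      ∑ x with f x ∈ T, ψ (-(B ((b : K₁) • a) x)) =
      ε * R * (Fintype.card K₂ * (if g a ∈ T then 1 else 0) - T.card) := by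
    intro b
    rw [h.card_mul_sum_char hT, if_neg (smul_ne_zero b.ne_zero ha), zero_add,
      if_congr (h.dual_smul_mem_iff hT b.ne_zero a) rfl rfl]
  rw [Finset.sum_congr rfl fun b _ => hu b,
    ← Finset.mul_sum _ _ (Fintype.card K₂ : ℂ), ← hN] at hS
  simp only [zero_smul, map_zero, LinearMap.zero_apply, neg_zero, AddChar.map_zero_eq_one,
    Finset.sum_const, nsmul_eq_mul, mul_one, Finset.card_univ, Fintype.card_units] at hS
  rw [Nat.cast_sub Fintype.card_pos, Nat.cast_one] at hS
  have hS' : ((Fintype.card K₁ : ℤ) - 1) *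
      (ε * R * (Fintype.card K₂ * (if g a ∈ T then 1 else 0) - T.card)) =
      Fintype.card K₂ * (Fintype.card K₁ * ({x | f x ∈ T ∧ B a x = 0} : Finset V).card)
       - Fintype.card K₂ * ({x | f x ∈ T} : Finset V).card := by
    exact_mod_cast hS
  have hsplit : (({x | f x ∈ T ∧ B a x = 0} : Finset V).card : ℤ) +
      ({x | f x ∈ T ∧ B a x ≠ 0} : Finset V).card = ({x | f x ∈ T} : Finset V).card := by
    rw [← Finset.filter_filter, ← Finset.filter_filter]
    exact_mod_cast Finset.card_filter_add_card_filter_not _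
  have hD := h.card_mul_card hT
  have hT2 := hT.two_mul_card
  linear_combination 2 * hS' + 2 * (Fintype.card K₁ : ℤ) * Fintype.card K₂ * hsplit
    + ((Fintype.card K₁ : ℤ) - 1) * hD + (Fintype.card K₁ - 1) * ε * R * hT2

/-- The ratio of any two weights exceeds `(q - 1) / q`. -/
lemma weight_lt_weight [DecidableEq K₁] [DecidableEq K₂] (h : IsDualPair B ψ χ f g ε e R)
    (hT : IsQuadraticClass T)
    (hpos : ε = 1 → 2 * (Fintype.card K₁ : ℤ) * Fintype.card K₂ < (Fintype.card K₂ - 1) * R)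
    (hneg : ε = -1 →
      2 * ((Fintype.card K₁ : ℤ) - 1) * Fintype.card K₂ < (Fintype.card K₂ - 1) * R)
    {a b : V} (ha : a ≠ 0) (hb : b ≠ 0) :
    ((Fintype.card K₁ : ℤ) - 1) * ({x | f x ∈ T ∧ B a x ≠ 0} : Finset V).card <
      Fintype.card K₁ * ({x | f x ∈ T ∧ B b x ≠ 0} : Finset V).card := by
  have hwa := h.card_mul_weight hT ha
  have hwb := h.card_mul_weight hT hb
  have hq : (1 : ℤ) < Fintype.card K₁ := by exact_mod_cast Fintype.one_lt_card
  have hQ : (1 : ℤ) < Fintype.card K₂ := by exact_mod_cast Fintype.one_lt_card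
  have hR : (0 : ℤ) < R := by exact_mod_cast h.odd_radius.pos
  generalize (Fintype.card K₁ : ℤ) = q at *
  generalize (Fintype.card K₂ : ℤ) = Q at *
  generalize (R : ℤ) = R at *
  generalize (({x | f x ∈ T ∧ B a x ≠ 0} : Finset V).card : ℤ) = wa at *
  generalize (({x | f x ∈ T ∧ B b x ≠ 0} : Finset V).card : ℤ) = wb at *
  obtain ⟨ta, hta, hta'⟩ : ∃ t : ℤ, (if g a ∈ T then 1 else 0) = t ∧ (t = 0 ∨ t = 1) := by
    split_ifs <;> simp
  obtain ⟨tb, htb, htb'⟩ : ∃ t : ℤ, (if g b ∈ T then 1 else 0) = t ∧ (t = 0 ∨ t = 1) := by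
    split_ifs <;> simp
  rw [hta] at hwa
  rw [htb] at hwb
  -- The critical pairs are ta = 0, tb = 1 for ε = 1 and ta = 1, tb = 0 for ε = -1; there the claim
  -- is exactly `hpos`, respectively `hneg`.
  have hY : (q - 1) * ((Q - 1) * R - 2 * ε * Q * ta) < q * ((Q - 1) * R - 2 * ε * Q * tb) := by
    have hqQ : 0 < (q - 1) * Q := by nlinarith
    rcases h.sign with rfl | rfl
    · have := hpos rfl
      rcases hta' with rfl | rfl <;> rcases htb' with rfl | rfl <;> nlinarith
    · have := hneg rfl
      rcases hta' with rfl | rfl <;> rcases htb' with rfl | rfl <;> nlinarith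
  have hc : 0 < (q - 1) * R := mul_pos (by linarith) hR
  have h2 : 0 < 2 * q * Q := by positivity
  have hm := mul_lt_mul_of_pos_left hY hc
  apply lt_of_mul_lt_mul_left _ h2.le
  linear_combination hm + (q - 1) * hwa - q * hwb

/-- At a point where b is nonzero, so is a, and exactly one z makes a + zb vanish; where b vanishes,
all z give the value of a. -/
lemma sum_weight [DecidableEq K₁] (D : Finset V) (a b : V)
    (hab : ∀ x ∈ D, B a x = 0 → B b x = 0) :
    ∑ z : K₁, ((D.filter fun x => B (a + z • b) x ≠ 0).card : ℤ) =
      Fintype.card K₁ * (D.filter fun x => B a x ≠ 0).card -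
        (D.filter fun x => B b x ≠ 0).card := by
  simp only [Finset.card_filter, Nat.cast_sum]
  rw [Finset.sum_comm, Finset.mul_sum, ← Finset.sum_sub_distrib]
  apply Finset.sum_congr rfl
  intro x hx
  simp only [map_add, map_smul, LinearMap.add_apply, LinearMap.smul_apply, smul_eq_mul]
  by_cases hb : B b x = 0
  · by_cases ha : B a x = 0 <;> simp [ha, hb]
  · have ha : B a x ≠ 0 := fun h => hb (hab x hx h)
    have hz : ∀ z : K₁, B a x + z * B b x = 0 ↔ z = -(B a x) / B b x := by
      intro z
      rw [eq_div_iff hb, add_comm, ← eq_neg_iff_add_eq_zero]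
    simp only [ne_eq, hz, ha, hb, not_false_eq_true, if_true, ite_not]
    rw [Finset.sum_congr rfl fun z _ => show
      ((if z = -(B a x) / B b x then 0 else 1 : ℕ) : ℤ)
        = 1 - if z = -(B a x) / B b x then 1 else 0 by split_ifs <;> simp]
    simp

/-- The Ashikhmin--Barg argument: all codewords of the code of `{x | f x ∈ T}` are minimal. -/
lemma exists_smul_of_forall [DecidableEq K₂] (h : IsDualPair B ψ χ f g ε e R)
    (hT : IsQuadraticClass T)
    (hpos : ε = 1 → 2 * (Fintype.card K₁ : ℤ) * Fintype.card K₂ < (Fintype.card K₂ - 1) * R)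
    (hneg : ε = -1 →
      2 * ((Fintype.card K₁ : ℤ) - 1) * Fintype.card K₂ < (Fintype.card K₂ - 1) * R)
    (a b : V) (hab : ∀ x, f x ∈ T → B a x = 0 → B b x = 0) : ∃ z : K₁, b = z • a := by
  classical
  by_contra! hz
  have hb : b ≠ 0 := fun h0 => hz 0 (by rw [h0, zero_smul])
  have hlt := fun {a b : V} => h.weight_lt_weight (a := a) (b := b) hT hpos hneg
  simp only [← Finset.filter_filter] at hlt
  set D : Finset V := {x | f x ∈ T}
  have hab' : ∀ x ∈ D, B a x = 0 → B b x = 0 := fun x hx => hab x (by simpa [D] using hx)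
  have hq : (1 : ℤ) < Fintype.card K₁ := by exact_mod_cast Fintype.one_lt_card
  by_cases ha : a = 0
  · subst ha
    have h1 := hlt hb hb
    have h2 : D.filter (fun x => B b x ≠ 0) = ∅ := by
      rw [Finset.filter_eq_empty_iff]
      intro x hx
      simpa using hab' x hx (by simp)
    simp [h2] at h1
  · have hne : ∀ z : K₁, a + z • b ≠ 0 := by
      intro z h0
      by_cases hz0 : z = 0
      · simp [hz0, ha] at h0
      · apply hz (-z⁻¹)
        rw [eq_neg_of_add_eq_zero_left h0, neg_smul, smul_neg, neg_neg, inv_smul_smul₀ hz0]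
    have hsum := sum_weight D a b hab'
    -- If b is not a multiple of a, no a + zb is zero, so the ratio bound applies to each z ≠ 0.
    -- With `hsum` this yields q wt(b) ≤ (q - 1) wt(a), against the bound for the pair a, b.
    have hle : ∑ z ∈ ({0}ᶜ : Finset K₁), ((Fintype.card K₁ : ℤ) - 1) *
        (D.filter fun x => B a x ≠ 0).card ≤
        ∑ z ∈ ({0}ᶜ : Finset K₁), (Fintype.card K₁ : ℤ) *
          (D.filter fun x => B (a + z • b) x ≠ 0).card :=
      Finset.sum_le_sum fun z _ => (hlt ha (hne z)).le
    rw [Fintype.sum_eq_add_sum_compl (0 : K₁), zero_smul, add_zero] at hsum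
    rw [Finset.sum_const, ← Finset.mul_sum, Finset.card_compl, Finset.card_singleton,
      nsmul_eq_mul, Nat.cast_sub Fintype.card_pos, Nat.cast_one] at hle
    have h1 := hlt ha hb
    rw [← eq_sub_iff_add_eq'] at hsum
    rw [hsum] at hle
    nlinarith

end IsDualPair

end CharacterSums

/-! ### Trace forms and canonical characters. -/

section TraceForms

/-- The trace inner product as a bilinear form. -/
noncomputable def traceBilin (K : Type*) [Field K] {t : ℕ} {L : Fin t → Type*}
    [∀ j, Field (L j)] [∀ j, Algebra K (L j)] : (∀ j, L j) →ₗ[K] (∀ j, L j) →ₗ[K] K :=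
  LinearMap.mk₂ K (tracePairing K)
    (fun a b x => by simp [tracePairing, add_mul, Finset.sum_add_distrib])
    (fun z a x => by simp [tracePairing, Finset.mul_sum])
    (fun a x y => by simp [tracePairing, mul_add, Finset.sum_add_distrib])
    (fun z a x => by simp [tracePairing, Finset.mul_sum])

section

variable {K : Type*} [Field K] {t : ℕ} {L : Fin t → Type*} [∀ j, Field (L j)]
  [∀ j, Algebra K (L j)]

lemma traceBilin_apply (a b : ∀ j, L j) : traceBilin K a b = tracePairing K a b := rfl

lemma traceBilin_comm (a b : ∀ j, L j) : traceBilin K a b = traceBilin K b a := by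
  simp [traceBilin_apply, tracePairing, mul_comm]

lemma eq_zero_of_traceBilin [Finite K] [∀ j, Finite (L j)] (a : ∀ j, L j)
    (h : ∀ x, traceBilin K a x = 0) : a = 0 := by
  funext j
  have hnd := (traceForm_nondegenerate K (L j)).1
  apply hnd
  intro y
  have := h (Pi.single j y)
  rw [traceBilin_apply, tracePairing, Finset.sum_eq_single j] at this
  · simpa using this
  · intro i _ hi
    simp [hi]
  · simp

end

variable {p : ℕ} [Fact p.Prime]

/-- The canonical additive character of a field of characteristic `p`. -/
noncomputable def traceChar (p : ℕ) [Fact p.Prime] (K : Type*) [Field K] [Algebra (ZMod p) K] :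
    AddChar K ℂ :=
  (ZMod.stdAddChar (N := p)).compAddMonoidHom (Algebra.trace (ZMod p) K).toAddMonoidHom

lemma traceChar_apply {K : Type*} [Field K] [Algebra (ZMod p) K] (x : K) :
    traceChar p K x = ZMod.stdAddChar (Algebra.trace (ZMod p) K x) := rfl

lemma isPrimitive_traceChar (K : Type*) [Field K] [Finite K] [Algebra (ZMod p) K] :
    (traceChar p K).IsPrimitive := by
  apply AddChar.IsPrimitive.of_ne_one
  intro h
  apply ZMod.isPrimitive_stdAddChar p (a := 1) one_ne_zero
  ext k
  obtain ⟨x, hx⟩ := Algebra.trace_surjective (ZMod p) K k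
  rw [AddChar.mulShift_apply, one_mul, ← hx, ← traceChar_apply, h]
  rfl

lemma isScalarTower_zmod (K L : Type*) [Field K] [Field L] [Algebra (ZMod p) K]
    [Algebra (ZMod p) L] [Algebra K L] : IsScalarTower (ZMod p) K L :=
  IsScalarTower.of_algebraMap_eq' (Subsingleton.elim _ _)

lemma trace_trace_zmod (K L : Type*) [Field K] [Field L] [Finite K] [Finite L]
    [Algebra (ZMod p) K] [Algebra (ZMod p) L] [Algebra K L] (x : L) :
    Algebra.trace (ZMod p) K (Algebra.trace K L x) = Algebra.trace (ZMod p) L x :=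
  have := isScalarTower_zmod (p := p) K L
  Algebra.trace_trace x

lemma tracePairing_zmod (K : Type*) [Field K] [Finite K] [Algebra (ZMod p) K] {t : ℕ}
    {L : Fin t → Type*} [∀ j, Field (L j)] [∀ j, Finite (L j)] [∀ j, Algebra (ZMod p) (L j)]
    [∀ j, Algebra K (L j)] (a x : ∀ j, L j) :
    tracePairing (ZMod p) a x = Algebra.trace (ZMod p) K (tracePairing K a x) := by
  simp [tracePairing, map_sum]

end TraceForms

/-! ### From Condition A to dual pairs, and the numerical condition. -/

section Dual

variable {p : ℕ} [Fact p.Prime] {t : ℕ} {rr : Fin t → ℕ} {r m s₁ s₂ : ℕ}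
    {K₁ K₂ M : Type*} {L : Fin t → Type*}
    [Field K₁] [Field K₂] [Field M] [∀ j, Field (L j)]
    [Fintype K₁] [Fintype K₂] [Fintype M] [∀ j, Fintype (L j)]
    [Algebra (ZMod p) M] [∀ j, Algebra (ZMod p) (L j)]
    [Algebra K₁ K₂] [Algebra K₂ M] [Algebra K₁ M] [IsScalarTower K₁ K₂ M]
    [∀ j, Algebra M (L j)] [∀ j, Algebra K₁ (L j)] [∀ j, IsScalarTower K₁ M (L j)]

lemma two_ne_zero_of_algebra (hp : p ≠ 2) (K : Type*) [Field K] [Algebra (ZMod p) K] :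
    (2 : K) ≠ 0 := by
  have : CharP K p := charP_of_injective_algebraMap (algebraMap (ZMod p) K).injective p
  intro h
  have h2 : ((2 : ℕ) : K) = 0 := by exact_mod_cast h
  rw [CharP.cast_eq_zero_iff K p] at h2
  exact hp ((Nat.prime_dvd_prime_iff_eq Fact.out Nat.prime_two).1 h2)

lemma sqrt_pow_two_mul (p k : ℕ) : ((Real.sqrt p : ℝ) : ℂ) ^ (2 * k) = ((p ^ k : ℕ) : ℂ) := by
  rw [pow_mul, ← Complex.ofReal_pow, Real.sq_sqrt (Nat.cast_nonneg p)]
  push_cast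
  rfl

/-- Transitivity of the trace rewrites Walsh transforms over the prime field with the canonical
characters of K₁ and K₂. -/
lemma exists_isDualPair [Algebra (ZMod p) K₁] [Algebra (ZMod p) K₂]
    (hM : Fintype.card M = p ^ m) (hL : ∀ j, Fintype.card (L j) = p ^ rr j)
    (hr : r = ∑ j, rr j) {F : (∀ j, L j) → M} {ε : ℤ} (hF : ConditionA p r m F ε) {lam : M}
    (hlam : lam ≠ 0) :
    ∃ (g : (∀ j, L j) → K₂) (e : ℕ),
      IsDualPair (traceBilin K₁) (traceChar p K₁) (traceChar p K₂)
        (fun x => Algebra.trace K₂ M (lam * F x)) g ε e (p ^ (r / 2)) := by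
  obtain ⟨G, σ, e, -, hW, -, hgcd, hσ, hG⟩ := hF.dual
  have hr2 : r = 2 * (r / 2) := (Nat.two_mul_div_two_of_even hF.even).symm
  -- For c = zλ with z in K₂, c^(-e) = z^(-e) λ^(-e), and the factor z^(-e) leaves the trace to K₂.
  refine ⟨fun a => Algebra.trace K₂ M (lam⁻¹ ^ e * G a), e, ?_⟩
  have hcardM : Nat.card Mˣ = p ^ m - 1 := by
    rw [Nat.card_units, Nat.card_eq_fintype_card, hM]
  have hodd : Odd e := by
    rw [← Nat.not_even_iff_odd]
    intro he
    have h1 : Odd (p ^ m) := ((Fact.out : p.Prime).odd_of_ne_two hF.odd).pow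
    have h2 : Even (p ^ m - 1) := by
      obtain ⟨k, hk⟩ := h1
      exact ⟨k, by omega⟩
    have h3 := Nat.dvd_gcd he.two_dvd h2.two_dvd
    rw [hgcd] at h3
    omega
  refine
    { prim₁ := isPrimitive_traceChar K₁
      prim₂ := isPrimitive_traceChar K₂
      nondegenerate := eq_zero_of_traceBilin
      odd := hodd
      coprime := ?_
      walsh := ?_
      card := ?_
      eval_zero := by simp [hF.map_zero]
      eval_neg := fun x => by simp only [hF.map_neg]
      dual_smul := ?_
      sign := hF.sign
      two_ne_zero := two_ne_zero_of_algebra hF.odd K₁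
      two_ne_zero' := two_ne_zero_of_algebra hF.odd K₂ }
  · have hdvd : Nat.card K₂ˣ ∣ Nat.card Mˣ :=
      Subgroup.card_dvd_of_injective (Units.map (algebraMap K₂ M).toMonoidHom)
        (Units.map_injective (algebraMap K₂ M).injective)
    rw [hcardM] at hdvd
    exact (Nat.Coprime.coprime_dvd_right hdvd hgcd).symm
  · intro z hz a
    have hc : algebraMap K₂ M z * lam ≠ 0 := mul_ne_zero (by simpa using hz) hlam
    have h := hW (Units.mk0 _ hc) a
    rw [DualBentCodes.walsh] at h
    have h1 : ∀ x, (ZMod.stdAddChar (component (p := p) F (Units.mk0 _ hc : Mˣ) x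
        - tracePairing (ZMod p) a x) : ℂ) =
        traceChar p K₂ (z * Algebra.trace K₂ M (lam * F x)) *
          traceChar p K₁ (-(traceBilin K₁ a x)) := by
      intro x
      rw [sub_eq_add_neg, AddChar.map_add_eq_mul, tracePairing_zmod K₁, ← map_neg,
        ← traceBilin_apply, traceChar_apply, traceChar_apply, component, Units.val_mk0,
        ← trace_trace_zmod K₂ M, mul_assoc, ← Algebra.smul_def, map_smul, smul_eq_mul]
    have h2 : component (p := p) G (σ (Units.mk0 _ hc) : Mˣ) a =
        Algebra.trace (ZMod p) K₂ (z⁻¹ ^ e * Algebra.trace K₂ M (lam⁻¹ ^ e * G a)) := by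
      have h3 : ((σ (Units.mk0 _ hc) : Mˣ) : M) = algebraMap K₂ M (z⁻¹ ^ e) * lam⁻¹ ^ e := by
        rw [hσ]
        simp [mul_pow, mul_comm]
      rw [component, h3, ← trace_trace_zmod K₂ M, mul_assoc, ← Algebra.smul_def, map_smul,
        smul_eq_mul]
    rw [Finset.sum_congr rfl fun x _ => h1 x, h2, ← traceChar_apply] at h
    nth_rewrite 1 [hr2] at h
    rw [sqrt_pow_two_mul] at h
    exact h
  · rw [Fintype.card_pi, Finset.prod_congr rfl fun j _ => hL j, Finset.prod_pow_eq_pow_sum,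
      ← hr, ← pow_mul, mul_comm, ← hr2]
  · intro b a hb
    obtain ⟨k, hk⟩ := hodd
    -- With e = 2k + 1, the homogeneity factor b^(e+1) is the square of b^(k+1).
    refine ⟨algebraMap K₁ K₂ b ^ (k + 1), pow_ne_zero _ (by simpa using hb), ?_⟩
    have hbM : algebraMap K₁ M b ≠ 0 := by simpa using hb
    have h1 : b • a = algebraMap K₁ M b • a := by
      funext j
      simp [Pi.smul_apply]
    have h2 := hG (Units.mk0 _ hbM) a
    rw [Units.val_mk0, ← h1, hk, show 2 * k + 1 + 1 = (k + 1) * 2 by ring,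
      IsScalarTower.algebraMap_apply K₁ K₂ M, ← map_pow, ← Algebra.smul_def, pow_mul] at h2
    rw [h2, mul_smul_comm, map_smul, smul_eq_mul]

/-- The numerical condition of Ashikhmin and Barg. -/
lemma two_mul_lt_of_exponents {p k s d : ℕ} (hp : 3 ≤ p) (hs : 0 < s) (hd : 0 < d)
    (hk : s * d ≤ k) (h₁ : s * d < k ∨ s * d ≠ s) (ε : ℤ)
    (h₂ : p = 3 ∧ k = 2 ∧ ε = 1 → s * d ≠ 1) (hk2 : 2 ≤ k) (h4 : p ≠ 4) :
    (ε = 1 → 2 * ((p ^ s : ℕ) : ℤ) * (p ^ (s * d) : ℕ) <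
      ((p ^ (s * d) : ℕ) - 1) * (p ^ k : ℕ)) ∧
    (ε = -1 → 2 * (((p ^ s : ℕ) : ℤ) - 1) * (p ^ (s * d) : ℕ) <
      ((p ^ (s * d) : ℕ) - 1) * (p ^ k : ℕ)) := by
  have hq3 : p ≤ p ^ s := Nat.le_self_pow hs.ne' p
  have hRQ : p ^ (s * d) ≤ p ^ k := Nat.pow_le_pow_right (by omega) hk
  -- Here q = p^s, Q = p^(sd), R = p^k. If d ≥ 2, then Q ≥ q² gives 2q < Q - 1, and R ≥ Q suffices.
  -- If d = 1, then Q = q and R ≥ pQ; for ε = 1 this is too weak only when p = Q = 3, where k ≥ 3 is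
  -- needed.
  rcases Nat.lt_or_ge 1 d with hd1 | hd1
  · have hQ : (p ^ s) ^ 2 ≤ p ^ (s * d) := by
      rw [← pow_mul]
      exact Nat.pow_le_pow_right (by omega) (Nat.mul_le_mul_left s hd1)
    zify at *
    generalize ((p : ℤ) ^ s) = q at *
    generalize ((p : ℤ) ^ (s * d)) = Q at *
    generalize ((p : ℤ) ^ k) = R at *
    have hmain : 2 * q * Q < (Q - 1) * R := by
      have h5 : 2 * q < Q - 1 := by nlinarith
      have h6 : (Q - 1) * Q ≤ (Q - 1) * R := mul_le_mul_of_nonneg_left hRQ (by linarith)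
      nlinarith
    exact ⟨fun _ => hmain, fun _ => by nlinarith⟩
  · obtain rfl : d = 1 := by omega
    rw [mul_one] at *
    have hlt : s < k := by omega
    have hR : p * p ^ s ≤ p ^ k := by
      rw [← pow_succ']
      exact Nat.pow_le_pow_right (by omega) hlt
    refine ⟨fun hε => ?_, fun hε => ?_⟩
    · by_cases hspec : p = 3 ∧ s = 1
      · obtain ⟨rfl, rfl⟩ := hspec
        have hk3 : 3 ≤ k := by
          by_contra h
          exact h₂ ⟨rfl, by omega, hε⟩ rfl
        have : 3 ^ 3 ≤ 3 ^ k := Nat.pow_le_pow_right (by omega) hk3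
        zify at this
        push_cast
        linarith
      · have h9 : (5 ≤ p ∧ 5 ≤ p ^ s) ∨ (3 ≤ p ∧ 9 ≤ p ^ s) := by
          by_cases hp3 : p = 3
          · subst hp3
            have hs2 : 2 ≤ s := by
              by_contra h
              exact hspec ⟨rfl, by omega⟩
            have : 3 ^ 2 ≤ 3 ^ s := Nat.pow_le_pow_right (by omega) hs2
            exact Or.inr ⟨le_rfl, by omega⟩
          · exact Or.inl ⟨by omega, by omega⟩
        have hR' : ((p * p ^ s : ℕ) : ℤ) ≤ (p ^ k : ℕ) := by exact_mod_cast hR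
        rw [Nat.cast_mul] at hR'
        generalize p ^ s = Q at *
        generalize p ^ k = R at *
        have h6 : ((Q : ℤ) - 1) * (p * Q) ≤ (Q - 1) * R :=
          mul_le_mul_of_nonneg_left hR' (by rcases h9 with h | h <;> omega)
        rcases h9 with ⟨h7, h8⟩ | ⟨h7, h8⟩
        · have h7' : (5 : ℤ) ≤ p := by exact_mod_cast h7
          have h8' : (5 : ℤ) ≤ Q := by exact_mod_cast h8
          have : ((Q : ℤ) - 1) * (5 * Q) ≤ (Q - 1) * (p * Q) := by
            apply mul_le_mul_of_nonneg_left _ (by linarith)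
            exact mul_le_mul_of_nonneg_right h7' (by linarith)
          nlinarith
        · have h7' : (3 : ℤ) ≤ p := by exact_mod_cast h7
          have h8' : (9 : ℤ) ≤ Q := by exact_mod_cast h8
          have : ((Q : ℤ) - 1) * (3 * Q) ≤ (Q - 1) * (p * Q) := by
            apply mul_le_mul_of_nonneg_left _ (by linarith)
            exact mul_le_mul_of_nonneg_right h7' (by linarith)
          nlinarith
    · have h3 : 3 * p ^ s ≤ p ^ k := (Nat.mul_le_mul_right _ hp).trans hR
      zify at *
      generalize ((p : ℤ) ^ s) = Q at *
      generalize ((p : ℤ) ^ k) = R at *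
      nlinarith

end Dual

/-! ### Trace codes: dual words and minimal words. -/

section TraceCodes

variable {K : Type*} [Field K] [Fintype K] {t : ℕ} {L : Fin t → Type*} [∀ j, Field (L j)]
  [∀ j, Fintype (L j)] [∀ j, Algebra K (L j)] {n : ℕ}

/-- By nondegeneracy of the trace form, dual words are the linear relations among the points. -/
lemma mem_dualCode_traceCode_iff {d : Fin n → ∀ j, L j} {u : Fin n → K} :
    u ∈ dualCode (traceCode K d) ↔ ∑ i, u i • d i = 0 := by
  have key : ∀ a, u ⬝ᵥ (fun i => tracePairing K a (d i)) = traceBilin K (∑ i, u i • d i) a := by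
    intro a
    simp only [map_sum, map_smul, LinearMap.sum_apply, LinearMap.smul_apply, smul_eq_mul,
      dotProduct, ← traceBilin_apply]
    exact Finset.sum_congr rfl fun i _ => by rw [traceBilin_comm]
  constructor
  · intro hu
    apply eq_zero_of_traceBilin (K := K)
    intro a
    rw [← key]
    exact hu _ ⟨a, rfl⟩
  · rintro h _ ⟨a, rfl⟩
    rw [key, h, map_zero, LinearMap.zero_apply]

lemma sum_support_of_mem_dualCode [DecidableEq K] {d : Fin n → ∀ j, L j} {u : Fin n → K}
    (hu : u ∈ dualCode (traceCode K d)) :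
    ∑ i with u i ≠ 0, u i • d i = 0 := by
  rw [← mem_dualCode_traceCode_iff.1 hu, Finset.sum_filter]
  refine Finset.sum_congr rfl fun i _ => ?_
  by_cases h : u i = 0 <;> simp [h]

lemma two_le_hammingNorm [DecidableEq K] {d : Fin n → ∀ j, L j} {u : Fin n → K}
    (hd : ∀ i, d i ≠ 0) (hu : u ∈ dualCode (traceCode K d)) (h0 : u ≠ 0) :
    2 ≤ hammingNorm u := by
  have h1 := hammingNorm_pos_iff.2 h0
  have h2 : hammingNorm u ≠ 1 := by
    intro h
    obtain ⟨i, hi⟩ := Finset.card_eq_one.1 h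
    have hs := sum_support_of_mem_dualCode hu
    have hui : i ∈ ({i | u i ≠ 0} : Finset (Fin n)) := by rw [hi]; simp
    rw [hi, Finset.sum_singleton] at hs
    exact (smul_ne_zero (by simpa using hui) (hd i)) hs
  omega

lemma three_le_hammingNorm [DecidableEq K] {d : Fin n → ∀ j, L j} {u : Fin n → K}
    (hd : ∀ i, d i ≠ 0) (hd' : ∀ i j, ∀ z : K, i ≠ j → d j ≠ z • d i)
    (hu : u ∈ dualCode (traceCode K d)) (h0 : u ≠ 0) : 3 ≤ hammingNorm u := by
  have h1 := two_le_hammingNorm hd hu h0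
  have h2 : hammingNorm u ≠ 2 := by
    intro h
    obtain ⟨i, j, hij, hi⟩ := Finset.card_eq_two.1 h
    have hs := sum_support_of_mem_dualCode hu
    have huj : j ∈ ({i | u i ≠ 0} : Finset (Fin n)) := by rw [hi]; simp
    have huj' : u j ≠ 0 := by simpa using huj
    rw [hi, Finset.sum_pair hij, add_comm] at hs
    apply hd' i j (-(u j)⁻¹ * u i) hij
    rw [mul_smul, neg_smul, ← smul_neg, ← eq_neg_of_add_eq_zero_left hs, inv_smul_smul₀ huj']
  omega

/-- Every point whose hyperplane contains all `d i` of the hyperplane of `a` is a multiple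
of `a`. -/
def IsMinimalSequence (K : Type*) [Field K] {t : ℕ} {L : Fin t → Type*} [∀ j, Field (L j)]
    [∀ j, Algebra K (L j)] {n : ℕ} (d : Fin n → ∀ j, L j) : Prop :=
  ∀ a b : ∀ j, L j, (∀ i, traceBilin K a (d i) = 0 → traceBilin K b (d i) = 0) →
    ∃ z : K, b = z • a

lemma IsMinimalSequence.allCodewordsMinimal {d : Fin n → ∀ j, L j}
    (hd : IsMinimalSequence K d) : AllCodewordsMinimal (traceCode K d) := by
  rintro _ ⟨a, rfl⟩ _ ⟨b, rfl⟩ h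
  obtain ⟨z, rfl⟩ := hd a b h
  refine ⟨z, ?_⟩
  funext i
  simp [← traceBilin_apply]

lemma IsMinimalSequence.card_traceCode {d : Fin n → ∀ j, L j}
    (hd : IsMinimalSequence K d) : Nat.card (traceCode K d) = Nat.card (∀ j, L j) := by
  symm
  apply Nat.card_congr
  apply Equiv.ofBijective (fun a => ⟨fun i => tracePairing K a (d i), a, rfl⟩)
  constructor
  · intro a b h
    have h1 : ∀ i, traceBilin K a (d i) = traceBilin K b (d i) := fun i =>
      congrFun (congrArg Subtype.val h) i
    -- Minimality at the zero word says that only the zero vector gives the zero codeword.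
    obtain ⟨z, hz⟩ := hd 0 (a - b) (fun i _ => by
      rw [map_sub, LinearMap.sub_apply, h1, sub_self])
    rwa [smul_zero, sub_eq_zero] at hz
  · rintro ⟨_, a, rfl⟩
    exact ⟨a, rfl⟩

/-- The number of minimal access sets that contain a given set of participants. -/
lemma IsMinimalSequence.ncard_minimalAccessSets {d : Fin (n + 1) → ∀ j, L j}
    (hd : IsMinimalSequence K d) {p r s k : ℕ} (hp : 0 < p) (hK : Fintype.card K = p ^ s)
    (hV : Fintype.card (∀ j, L j) = p ^ r) {H : Matrix (Fin k) (Fin (n + 1)) K}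
    (hH : IsGeneratorMatrix H (dualCode (traceCode K d))) (P : Finset (Fin n))
    (hP : ∀ u ∈ dualCode (traceCode K d), (∀ i ∉ P, u (Fin.succ i) = 0) → u = 0)
    (hs : s * (P.card + 1) ≤ r) :
    {A ∈ minimalAccessSets H | P ⊆ A}.ncard =
      p ^ (r - s * (P.card + 1)) * (p ^ s - 1) ^ P.card := by
  have h := ncard_codewords_mul P hP
  rw [_root_.ncard_minimalAccessSets hH hd.allCodewordsMinimal]
  rw [hd.card_traceCode, Nat.card_eq_fintype_card, hV, hK, ← pow_mul] at h
  apply Nat.eq_of_mul_eq_mul_right (pow_pos hp (s * (P.card + 1)))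
  rw [h, mul_right_comm, ← pow_add, Nat.sub_add_cancel hs]

lemma IsMinimalSequence.ncard_minimalAccessSets_empty {d : Fin (n + 1) → ∀ j, L j}
    (hd : IsMinimalSequence K d) (hd0 : ∀ i, d i ≠ 0) {p r s k : ℕ} (hp : 0 < p)
    (hK : Fintype.card K = p ^ s) (hV : Fintype.card (∀ j, L j) = p ^ r)
    {H : Matrix (Fin k) (Fin (n + 1)) K}
    (hH : IsGeneratorMatrix H (dualCode (traceCode K d))) (hs : s ≤ r) :
    (minimalAccessSets H).ncard = p ^ (r - s) := by
  classical
  have h := hd.ncard_minimalAccessSets hp hK hV hH ∅ (by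
    intro u hu h0
    by_contra hne
    have h2 := two_le_hammingNorm hd0 hu hne
    have h3 : hammingNorm u ≤ ({0} : Finset (Fin (n + 1))).card := by
      apply Finset.card_le_card
      intro i hi
      refine Fin.cases (by simp) (fun j hj => ?_) i hi
      simp [h0 j] at hj
    simp at h3
    omega) (by simpa using hs)
  simpa using h

end TraceCodes

/-! ### The two secret sharing schemes. -/

section Schemes

variable {K : Type*} [Field K] [Fintype K] {t : ℕ} {L : Fin t → Type*} [∀ j, Field (L j)]
  [∀ j, Fintype (L j)] [∀ j, Algebra K (L j)] {n p r s : ℕ}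

lemma col_eq_smul_col_iff {d : Fin (n + 1) → ∀ j, L j} {k : ℕ}
    {G : Matrix (Fin k) (Fin (n + 1)) K} (hG : IsGeneratorMatrix G (traceCode K d))
    (i j : Fin (n + 1)) (z : K) : G.col i = z • G.col j ↔ d i = z • d j := by
  constructor
  · intro h
    rw [← sub_eq_zero]
    apply eq_zero_of_traceBilin (K := K)
    intro a
    have ha : (fun i => tracePairing K a (d i)) ∈ traceCode K d := ⟨a, rfl⟩
    rw [← hG.2, Submodule.mem_span_range_iff_exists_fun] at ha
    obtain ⟨v, hv⟩ := ha
    have hv' : ∀ i, traceBilin K (d i) a = ∑ l, v l * G l i := by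
      intro i
      rw [traceBilin_comm, traceBilin_apply, ← congrFun hv i]
      simp [Finset.sum_apply, Matrix.row]
    rw [map_sub, map_smul, LinearMap.sub_apply, LinearMap.smul_apply, hv', hv', sub_eq_zero,
      smul_eq_mul, Finset.mul_sum]
    apply Finset.sum_congr rfl
    intro l _
    have := congrFun h l
    simp only [Matrix.col_apply, Pi.smul_apply, smul_eq_mul] at this
    rw [this]
    ring
  · intro h
    funext l
    have hl : G.row l ∈ traceCode K d := by
      rw [← hG.2]
      exact Submodule.subset_span ⟨l, rfl⟩
    obtain ⟨a, ha⟩ := hl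
    have hl' : ∀ i, G l i = traceBilin K a (d i) := fun i => congrFun ha i
    simp only [Matrix.col_apply, Pi.smul_apply, smul_eq_mul, hl', h, map_smul]

lemma scheme_of_neg_mem {d : Fin (n + 1) → ∀ j, L j}
    (hd : IsMinimalSequence K d) (hd0 : ∀ i, d i ≠ 0) (hneg : ∀ i, ∃ j, d j = - d i)
    (h2 : (2 : K) ≠ 0) (hp : 0 < p) (hK : Fintype.card K = p ^ s)
    (hV : Fintype.card (∀ j, L j) = p ^ r) (hs : 2 * s ≤ r) {k k' : ℕ}
    {G : Matrix (Fin k) (Fin (n + 1)) K} {H : Matrix (Fin k') (Fin (n + 1)) K}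
    (hG : IsGeneratorMatrix G (traceCode K d))
    (hH : IsGeneratorMatrix H (dualCode (traceCode K d))) :
    minDist (dualCode (traceCode K d)) = 2 ∧
    (minimalAccessSets H).ncard = p ^ (r - s) ∧
    ∀ i : Fin n,
      ((∃ z : K, G.col i.succ = z • G.col 0) → ∀ A ∈ minimalAccessSets H, i ∈ A) ∧
      ((¬ ∃ z : K, G.col i.succ = z • G.col 0) →
        {A ∈ minimalAccessSets H | i ∈ A}.ncard = (p ^ s - 1) * p ^ (r - 2 * s)) := by
  classical
  refine ⟨?_, hd.ncard_minimalAccessSets_empty hd0 hp hK hV hH (by omega), fun i => ⟨?_, ?_⟩⟩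
  · obtain ⟨j, hj⟩ := hneg 0
    have hj0 : j ≠ 0 := by
      rintro rfl
      have h3 : (2 : K) • d 0 = 0 := by
        rw [two_smul]
        nth_rewrite 1 [hj]
        simp
      rw [smul_eq_zero_iff_right h2] at h3
      exact hd0 0 h3
    -- The relation d 0 + d j = 0 as a dual word.
    let u : Fin (n + 1) → K := Pi.single 0 1 + Pi.single j 1
    have hu : u ∈ dualCode (traceCode K d) := by
      rw [mem_dualCode_traceCode_iff]
      simp [u, add_smul, Finset.sum_add_distrib, Pi.single_apply, ite_smul, hj]
    have hu0 : u ≠ 0 := by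
      intro h
      have := congrFun h 0
      simp [u, hj0.symm] at this
    have hmem : hammingNorm u ∈
        {w | ∃ c ∈ dualCode (traceCode K d), c ≠ 0 ∧ hammingNorm c = w} := ⟨u, hu, hu0, rfl⟩
    have hle : hammingNorm u ≤ 2 := by
      calc hammingNorm u ≤ ({0, j} : Finset (Fin (n + 1))).card := by
            apply Finset.card_le_card
            intro i hi
            by_contra h
            simp only [Finset.mem_insert, Finset.mem_singleton, not_or] at h
            simp [u, h.1, h.2] at hi
        _ ≤ 2 := Finset.card_le_two
    apply le_antisymm
    · refine le_trans (Nat.sInf_le ?_) hle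
      convert hmem
    · apply le_csInf ⟨_, by convert hmem⟩
      rintro w ⟨c, hc, hc0, rfl⟩
      convert two_le_hammingNorm hd0 hc hc0
  · rintro ⟨z, hz⟩ A hA
    rw [col_eq_smul_col_iff hG] at hz
    -- The codeword has entry 1 at 0, hence z at i. If i were outside A, z would vanish, and with it
    -- the point d i.
    obtain ⟨_, ⟨a, rfl⟩, h0, hcA⟩ := (isAccessSet_iff hH A).1 hA.1
    by_contra hi
    have h1 := hcA i hi
    simp only [← traceBilin_apply] at h0 h1
    rw [hz, map_smul, h0, smul_eq_mul, mul_one] at h1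
    exact hd0 i.succ (by rw [hz, h1, zero_smul])
  · intro hz
    have h := hd.ncard_minimalAccessSets hp hK hV hH {i} (by
      intro u hu h0
      have hsum := mem_dualCode_traceCode_iff.1 hu
      rw [Fin.sum_univ_succ, Finset.sum_eq_single i] at hsum
      · have hui : u i.succ = 0 := by
          by_contra hui
          refine hz ⟨-(u i.succ)⁻¹ * u 0, ?_⟩
          rw [col_eq_smul_col_iff hG, mul_smul, neg_smul, ← smul_neg,
            ← eq_neg_of_add_eq_zero_right hsum, inv_smul_smul₀ hui]
        rw [hui, zero_smul, add_zero, smul_eq_zero_iff_left (hd0 0)] at hsum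
        funext j
        refine Fin.cases hsum (fun j => ?_) j
        by_cases hj : j = i
        · rw [hj, hui]
          rfl
        · exact h0 j (by simpa using hj)
      · intro j _ hj
        rw [h0 j (by simpa using hj), zero_smul]
      · simp) (by simp; omega)
    simp only [Finset.singleton_subset_iff, Finset.card_singleton, pow_one] at h
    rw [h, mul_comm, mul_comm s, mul_comm]

/-- Needed because `minDist` of the zero code is 0. If the dual were zero, C would be the whole
space: in length at least 2 the all-one word is not minimal, and in length 1 the dimension is too
small. -/
lemma exists_ne_zero_mem_dualCode {d : Fin (n + 1) → ∀ j, L j}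
    (hd : IsMinimalSequence K d) (hp : 1 < p) (hK : Fintype.card K = p ^ s)
    (hV : Fintype.card (∀ j, L j) = p ^ r) (hs : s < r) :
    ∃ u ∈ dualCode (traceCode K d), u ≠ 0 := by
  by_contra! h
  have htop : ∀ c, c ∈ traceCode K d := by
    intro c
    apply mem_of_mem_dualCode_dualCode
    intro v hv
    rw [h v hv, dotProduct_zero]
  rcases n with _ | n
  · have h1 := hd.card_traceCode
    rw [(Submodule.eq_top_iff'.2 htop : traceCode K d = ⊤),
      Nat.card_congr Submodule.topEquiv.toEquiv, Nat.card_eq_fintype_card,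
      Nat.card_eq_fintype_card, hV, Fintype.card_fun, hK] at h1
    simp only [zero_add, Fintype.card_fin, pow_one] at h1
    exact hs.ne (Nat.pow_right_injective hp h1)
  · obtain ⟨z, hz⟩ := hd.allCodewordsMinimal 1 (htop _) (Pi.single 0 1) (htop _) (by simp)
    have h0 := congrFun hz 0
    have h1 := congrFun hz 1
    simp at h0 h1
    rw [← h1] at h0
    exact one_ne_zero h0

lemma scheme_of_pairwise_independent {w : Fin (n + 1) → ∀ j, L j}
    (hd : IsMinimalSequence K w) (hd0 : ∀ i, w i ≠ 0)
    (hd' : ∀ i j, ∀ z : K, i ≠ j → w j ≠ z • w i)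
    (hp : 1 < p) (hK : Fintype.card K = p ^ s)
    (hV : Fintype.card (∀ j, L j) = p ^ r) (hs : s < r) {k : ℕ}
    {H : Matrix (Fin k) (Fin (n + 1)) K}
    (hH : IsGeneratorMatrix H (dualCode (traceCode K w))) :
    3 ≤ minDist (dualCode (traceCode K w)) ∧
    (minimalAccessSets H).ncard = p ^ (r - s) ∧
    ∀ l : ℕ, 1 ≤ l → l ≤ min (r / s - 1) (minDist (dualCode (traceCode K w)) - 2) →
      ∀ P : Finset (Fin n), P.card = l →
        {A ∈ minimalAccessSets H | P ⊆ A}.ncard = p ^ (r - s * (l + 1)) * (p ^ s - 1) ^ l := by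
  classical
  have h3 : 3 ≤ minDist (dualCode (traceCode K w)) := by
    obtain ⟨u, hu, hu0⟩ := exists_ne_zero_mem_dualCode hd hp hK hV hs
    rw [minDist]
    refine le_csInf ⟨_, u, hu, hu0, rfl⟩ ?_
    rintro _ ⟨c, hc, hc0, rfl⟩
    convert three_le_hammingNorm hd0 hd' hc hc0
  refine ⟨h3, hd.ncard_minimalAccessSets_empty hd0 (by omega) hK hV hH hs.le, ?_⟩
  rintro l hl1 hl P rfl
  have hl2 := hl.trans (min_le_left _ _)
  have hl3 := hl.trans (min_le_right _ _)
  apply hd.ncard_minimalAccessSets (by omega) hK hV hH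
  · intro u hu h0
    by_contra hne
    have h4 : minDist (dualCode (traceCode K w)) ≤ hammingNorm u := by
      apply Nat.sInf_le
      refine ⟨u, hu, hne, ?_⟩
      congr!
    -- Such a word has weight at most l + 1, below the dual distance.
    have h5 : hammingNorm u ≤ (insert 0 (P.image Fin.succ)).card := by
      apply Finset.card_le_card
      intro i
      refine Fin.cases (by simp) (fun j hj => ?_) i
      by_contra hjP
      have : j ∉ P := fun h => hjP (by simp [h])
      simp [h0 j this] at hj
    have h6 := Finset.card_insert_le (0 : Fin (n + 1)) (P.image Fin.succ)
    have h7 := Finset.card_image_le (s := P) (f := Fin.succ)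
    omega
  · calc s * (P.card + 1) ≤ s * (r / s) := Nat.mul_le_mul_left s (by omega)
      _ ≤ r := Nat.mul_div_le r s

end Schemes

/-- The map (i, c) ↦ c w_i from pairs with c a unit is onto D; equal cardinalities make it
injective. -/
lemma not_proportional_of_card {K V ι : Type*} [Field K] [Fintype K] [AddCommGroup V]
    [Module K V] [Fintype ι] {D : Finset V} {w : ι → V}
    (hD : ∀ x, x ∈ D ↔ ∃ i, ∃ c : K, c ≠ 0 ∧ x = c • w i) (hw : ∀ i, w i ≠ 0)
    (hcard : D.card = Fintype.card ι * (Fintype.card K - 1)) (i j : ι) (z : K) (hij : i ≠ j) :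
    w j ≠ z • w i := by
  classical
  intro h
  have himg : (Finset.univ : Finset (ι × Kˣ)).image (fun x => (x.2 : K) • w x.1) = D := by
    ext x
    simp only [hD, Finset.mem_image, Finset.mem_univ, true_and, Prod.exists]
    constructor
    · rintro ⟨i, c, rfl⟩
      exact ⟨i, c, c.ne_zero, rfl⟩
    · rintro ⟨i, c, hc, rfl⟩
      exact ⟨i, Units.mk0 c hc, rfl⟩
  have hinj := Finset.card_image_iff.1 (show (Finset.image (fun x : ι × Kˣ => (x.2 : K) • w x.1)
      Finset.univ).card = (Finset.univ : Finset (ι × Kˣ)).card by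
    rw [himg, hcard, Finset.card_univ, Fintype.card_prod, Fintype.card_units])
  have hz : z ≠ 0 := by
    rintro rfl
    exact hw j (by rw [h, zero_smul])
  have := hinj (Finset.mem_coe.2 (Finset.mem_univ (i, Units.mk0 z hz)))
    (Finset.mem_coe.2 (Finset.mem_univ (j, 1))) (by simp [h])
  exact hij (congrArg Prod.fst this)

/-! ### The main theorem. -/

theorem proposition5
    {p : ℕ} [Fact p.Prime] {t : ℕ} {rr : Fin t → ℕ} {r m s₁ s₂ : ℕ}
    -- the tower of fields with `p ^ s₁`, `p ^ s₂`, `p ^ m` and `p ^ rr j` elements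
    {K₁ K₂ M : Type*} {L : Fin t → Type*}
    [Field K₁] [Field K₂] [Field M] [∀ j, Field (L j)]
    [Fintype K₁] [Fintype K₂] [Fintype M] [∀ j, Fintype (L j)]
    [Algebra (ZMod p) M] [∀ j, Algebra (ZMod p) (L j)]
    [Algebra K₁ K₂] [Algebra K₂ M] [Algebra K₁ M] [IsScalarTower K₁ K₂ M]
    [∀ j, Algebra M (L j)] [∀ j, Algebra K₁ (L j)] [∀ j, IsScalarTower K₁ M (L j)]
    (hK₁ : Fintype.card K₁ = p ^ s₁) (hK₂ : Fintype.card K₂ = p ^ s₂)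
    (hM : Fintype.card M = p ^ m) (hL : ∀ j, Fintype.card (L j) = p ^ rr j)
    (hr : r = ∑ j, rr j)
    (F : (∀ j, L j) → M) (ε : ℤ) (hF : ConditionA p r m F ε)
    (lam : M) (hlam : lam ≠ 0)
    (T : Set K₂) (hT : T = squareSet K₂ ∨ T = nonsquareSet K₂)
    (h₁ : s₂ < r / 2 ∨ s₂ ≠ s₁)
    (h₂ : p = 3 ∧ r = 4 ∧ ε = 1 → s₂ ≠ 1) :
    -- the code on all of `D(F)`
    (∀ (n : ℕ) (d : Fin (n + 1) → ∀ j, L j),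
      Function.Injective d → Set.range d = defSet F lam T →
      ∀ (k k' : ℕ) (G : Matrix (Fin k) (Fin (n + 1)) K₁) (H : Matrix (Fin k') (Fin (n + 1)) K₁),
      IsGeneratorMatrix G (traceCode K₁ d) → IsGeneratorMatrix H (dualCode (traceCode K₁ d)) →
        minDist (dualCode (traceCode K₁ d)) = 2 ∧
        (minimalAccessSets H).ncard = p ^ (r - s₁) ∧
        ∀ i : Fin n,
          ((∃ z : K₁, G.col i.succ = z • G.col 0) → ∀ A ∈ minimalAccessSets H, i ∈ A) ∧
          ((¬ ∃ z : K₁, G.col i.succ = z • G.col 0) →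
            {A ∈ minimalAccessSets H | i ∈ A}.ncard = (p ^ s₁ - 1) * p ^ (r - 2 * s₁))) ∧
    -- the code on representatives of `D(F)` modulo nonzero scalars of `K₁`
    ((∃ l₀ : ℕ, 0 < l₀ ∧ Even l₀ ∧
        ∀ (c : M) (x : ∀ j, L j), c ≠ 0 → F (c • x) = c ^ l₀ * F x) →
      ∀ (n : ℕ) (w : Fin (n + 1) → ∀ j, L j),
      Function.Injective w →
      defSet F lam T = (⋃ i, {x | ∃ c : K₁, c ≠ 0 ∧ x = c • w i}) →
      2 * ((p : ℤ) ^ s₁ - 1) * (n + 1) =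
        ((p : ℤ) ^ s₂ - 1) * ((p : ℤ) ^ (r - s₂) - ε * (p : ℤ) ^ (r / 2 - s₂)) →
      ∀ (k' : ℕ) (H : Matrix (Fin k') (Fin (n + 1)) K₁),
      IsGeneratorMatrix H (dualCode (traceCode K₁ w)) →
        3 ≤ minDist (dualCode (traceCode K₁ w)) ∧
        (minimalAccessSets H).ncard = p ^ (r - s₁) ∧
        ∀ l : ℕ, 1 ≤ l → l ≤ min (r / s₁ - 1) (minDist (dualCode (traceCode K₁ w)) - 2) →
          ∀ P : Finset (Fin n), P.card = l →
            {A ∈ minimalAccessSets H | P ⊆ A}.ncard =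
              p ^ (r - s₁ * (l + 1)) * (p ^ s₁ - 1) ^ l) := by
  classical
  have hp : p.Prime := Fact.out
  have := charP_of_card_eq_prime_pow hK₁
  have := charP_of_card_eq_prime_pow hK₂
  -- These structures fit the given towers, as ring homomorphisms out of the prime field are unique.
  let _ := ZMod.algebra K₁ p
  let _ := ZMod.algebra K₂ p
  obtain ⟨g, e, h⟩ := exists_isDualPair (K₁ := K₁) (K₂ := K₂) hM hL hr hF hlam
  have hTq : IsQuadraticClass T.toFinset := isQuadraticClass_toFinset h.two_ne_zero' hT
  have hp3 : 3 ≤ p := by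
    have := hp.two_le
    have := hF.odd
    omega
  have hs₁ : 0 < s₁ := by
    rw [Nat.pos_iff_ne_zero]
    rintro rfl
    exact (Fintype.one_lt_card (α := K₁)).ne' (by simpa using hK₁)
  obtain ⟨δ, hδ⟩ : ∃ δ, s₂ = s₁ * δ := by
    have h3 := Module.card_eq_pow_finrank (K := K₁) (V := K₂)
    rw [hK₁, hK₂, ← pow_mul] at h3
    exact ⟨_, Nat.pow_right_injective hp.two_le h3⟩
  have hs₂ : 0 < s₂ := by
    rw [Nat.pos_iff_ne_zero]
    rintro rfl
    exact (Fintype.one_lt_card (α := K₂)).ne' (by simpa using hK₂)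
  have hδ0 : 0 < δ := Nat.pos_of_ne_zero (by rintro rfl; simp at hδ; omega)
  have hs₂m : s₂ ≤ m := by
    have h3 := Module.card_eq_pow_finrank (K := K₂) (V := M)
    rw [hM, hK₂, ← pow_mul] at h3
    rw [Nat.pow_right_injective hp.two_le h3]
    exact Nat.le_mul_of_pos_right _ Module.finrank_pos
  have hs₂r : s₂ ≤ r / 2 := hs₂m.trans hF.le_half
  have hs₁₂ : s₁ ≤ s₂ := hδ ▸ Nat.le_mul_of_pos_right _ hδ0
  have hr4 := hF.four_le
  have hr2 : r = 2 * (r / 2) := (Nat.two_mul_div_two_of_even hF.even).symm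
  have hV : Fintype.card (∀ j, L j) = p ^ r := by
    rw [h.card, ← pow_mul, mul_comm, ← hr2]
  have hnum := two_mul_lt_of_exponents (k := r / 2) hp3 hs₁ hδ0 (hδ ▸ hs₂r) (hδ ▸ h₁) ε
    (fun hh => hδ ▸ h₂ ⟨hh.1, by omega, hh.2.2⟩) (by omega)
    (by rintro rfl; revert hp; decide)
  rw [← hδ, ← hK₁, ← hK₂] at hnum
  have hmin := h.exists_smul_of_forall hTq hnum.1 hnum.2
  -- The condition x ≠ 0 is automatic, since F(0) = 0 and 0 ∉ T.
  have hmem : ∀ x, x ∈ defSet F lam T ↔ Algebra.trace K₂ M (lam * F x) ∈ T.toFinset := by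
    intro x
    rw [defSet, Set.mem_ofPred_eq, Set.mem_toFinset]
    refine ⟨fun hx => hx.2, fun hx => ⟨?_, hx⟩⟩
    rintro rfl
    apply hTq.zero_notMem
    rw [Set.mem_toFinset]
    simpa [hF.map_zero] using hx
  constructor
  · intro n d _ hrange k k' G H hG hH
    have hdmem : ∀ i, d i ∈ defSet F lam T := fun i => hrange ▸ ⟨i, rfl⟩
    refine scheme_of_neg_mem ?_ (fun i => (hdmem i).1) (fun i => ?_) h.two_ne_zero hp.pos hK₁ hV
      (by omega) hG hH
    · intro a b hab
      apply hmin a b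
      intro x hx
      rw [← hmem, ← hrange] at hx
      obtain ⟨i, rfl⟩ := hx
      exact hab i
    · have : -d i ∈ Set.range d := by
        rw [hrange]
        exact ⟨neg_ne_zero.2 (hdmem i).1, by rw [hF.map_neg]; exact (hdmem i).2⟩
      exact this
  · rintro - n w _ hD hn k' H hH
    have hDi : ∀ x, x ∈ defSet F lam T ↔ ∃ i, ∃ c : K₁, c ≠ 0 ∧ x = c • w i := by
      intro x
      rw [hD]
      simp
    have hwmem : ∀ i, w i ∈ defSet F lam T := fun i => (hDi _).2 ⟨i, 1, one_ne_zero, by simp⟩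
    refine scheme_of_pairwise_independent ?_ (fun i => (hwmem i).1) ?_ hp.one_lt hK₁ hV
      (by omega) hH
    · intro a b hab
      apply hmin a b
      intro x hx
      rw [← hmem, hDi] at hx
      obtain ⟨i, c, hc, rfl⟩ := hx
      rw [map_smul, map_smul, smul_eq_zero_iff_right hc, smul_eq_zero_iff_right hc]
      exact hab i
    · refine not_proportional_of_card
        (D := {x | Algebra.trace K₂ M (lam * F x) ∈ T.toFinset})
        (fun x => by rw [← hDi, hmem]; simp) (fun i => (hwmem i).1) ?_
      -- The length assumed for w is |D|/(q - 1), by the formula for |D| with the factor Q cleared.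
      have hcard := h.card_mul_card hTq
      rw [Fintype.card_fin]
      zify [(Fintype.card_pos : 0 < Fintype.card K₁)]
      rw [hK₂] at hcard
      rw [hK₁]
      have e1 : (p : ℤ) ^ (r - s₂) * p ^ s₂ = (p ^ (r / 2)) ^ 2 := by
        rw [← pow_add, Nat.sub_add_cancel (by omega), ← pow_mul, mul_comm, ← hr2]
      have e2 : (p : ℤ) ^ (r / 2 - s₂) * p ^ s₂ = p ^ (r / 2) := by
        rw [← pow_add, Nat.sub_add_cancel hs₂r]
      have hQ : (2 * (p : ℤ) ^ s₂) ≠ 0 := by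
        have := hp.ne_zero
        positivity
      apply mul_left_cancel₀ hQ
      push_cast at hcard ⊢
      linear_combination hcard - (p : ℤ) ^ s₂ * hn
        - ((p : ℤ) ^ s₂ - 1) * e1 + ((p : ℤ) ^ s₂ - 1) * ε * e2
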